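/- Let $G=\mathrm{PSL}(2,\mathbb{C})\rtimes\mathbb{Z}_2$, where the generator $c$ of $\mathbb{Z}_2$ acts by complex conjugation; this is the isometry group of $\mathbb{H}^3$ in the upper half-space model. Let $G_-=\{[A]c : A\in \mathrm{SL}(2,\mathbb{C})\}$ be the set of orientation-reversing elements, and let $Q:G\to \mathrm{SL}(2,\mathbb{C})$ be the square map, given by $Q([A])=A^2$ on $\mathrm{PSL}(2,\mathbb{C})$ and by $Q([A]c)=A\overline{A}$ on $G_-$. For $C\in\mathrm{SL}(2,\mathbb{C})$ put $$X_3(C)=\{(A_1,A_2,A_3)\in (G_-)^3 \mid Q(A_1)Q(A_2)Q(A_3)=C\},$$ $$X'_3(C)=\{(A_1,A_2,A_3)\in X_3(C)\mid \exists\, i,j \text{ with } [Q(A_i),Q(A_j)]\neq \mathrm{Id}\},$$ with the topology of subsets of $G^3$. Let $\pi_1(N_3)=\langle a_1,a_2,a_3\mid a_1^2a_2^2a_3^2=1\rangle$ be the fundamental group of the closed non-orientable surface of genus $3$. Let $\mathrm{hom}^{tp}(\pi_1(N_3),G)$ be the space, with the topology of pointwise convergence, of the homomorphisms $\phi:\pi_1(N_3)\to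 G$ that preserve the orientation type, i.e. $\phi(\gamma)\in G_-$ if and only if $\gamma$ reverses the orientation. For such $\phi$ one has $Q(\phi(a_1))Q(\phi(a_2))Q(\phi(a_3))=\pm\mathrm{Id}$; let the second Stiefel-Whitney class $w_2(\phi)\in\mathbb{Z}_2$ be $0$ if the sign is $+$ and $1$ if it is $-$. Then: 1. $X'_3(\mathrm{Id})$ and $X'_3(-\mathrm{Id})$ are non-empty and connected. 2. $X'_3(\pm\mathrm{Id})$ is dense in $X_3(\pm\mathrm{Id})$. 3. $X_3(\mathrm{Id})$ and $X_3(-\mathrm{Id})$ are non-empty and connected. 4. The map $\phi\mapsto(\phi(a_1),\phi(a_2),\phi(a_3))$ is a topological embedding of $\mathrm{hom}^{tp}(\pi_1(N_3),G)$ into $G^3$ which carries $w_2^{-1}(0)$ onto $X_3(\mathrm{Id})$ and $w_2^{-1}(1)$ onto $X_3(-\mathrm{Id})$. One has $w_2(\phi)=0$ if and only if $\phi$ lifts to a homomorphism $\pi_1(N_3)\to\mathrm{SL}(2,\mathbb{C})\rtimes\mathbb{Z}_2$ (with $\mathbb{Z}_2$ acting by complex conjugation). The connected components of $\mathrm{hom}^{tp}(\pi_1(N_3),G)$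 are exactly the two fibres $w_2^{-1}(0)$ and $w_2^{-1}(1)$. -/

import Mathlib

open scoped MatrixGroups commutatorElement

noncomputable section

namespace IsomH3

/-- The cyclic group of order two, written multiplicatively. -/
abbrev Z2 : Type := Multiplicative (ZMod 2)

/-- The action of `Z2` on a group by an involutive automorphism `σ`. -/
def involutionAction {H : Type*} [Group H] (σ : MulAut H) (hσ : σ * σ = 1) : Z2 →* MulAut H where
  toFun ε := if ε = 1 then 1 else σ
  map_one' := if_pos rfl
  map_mul' a b := by
    have key : ∀ x : Z2, x = 1 ∨ x = Multiplicative.ofAdd 1 := by decide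
    have h1 : (Multiplicative.ofAdd 1 : Z2) ≠ 1 := by decide
    have h2 : (Multiplicative.ofAdd 1 * Multiplicative.ofAdd 1 : Z2) = 1 := by decide
    rcases key a with rfl | rfl <;> rcases key b with rfl | rfl <;>
      simp only [mul_one, one_mul, if_true, h1, h2, if_false, hσ]

/-- Entrywise complex conjugation on `SL(2, ℂ)`. -/
def conjSL : MulAut SL(2, ℂ) :=
  MonoidHom.toMulEquiv (Matrix.SpecialLinearGroup.map (starRingEnd ℂ))
    (Matrix.SpecialLinearGroup.map (starRingEnd ℂ))
    (by ext A i j; simp) (by ext A i j; simp)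

theorem conjSL_mul_self : conjSL * conjSL = 1 := by
  ext A i j
  simp [conjSL]

theorem map_conjSL_center :
    (Subgroup.center SL(2, ℂ)).map (conjSL : SL(2, ℂ) →* SL(2, ℂ)) = Subgroup.center SL(2, ℂ) :=
  Subgroup.characteristic_iff_map_eq.1 inferInstance conjSL

/-- Complex conjugation on `PSL(2, ℂ)`, `[A] ↦ [Ā]`. -/
def conjPSL : MulAut PSL(2, ℂ) :=
  QuotientGroup.congr _ _ conjSL map_conjSL_center

theorem conjPSL_mul_self : conjPSL * conjPSL = 1 := by
  ext x
  induction x using QuotientGroup.induction_on with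
  | H A => 
    have h : conjSL (conjSL A) = A := DFunLike.congr_fun conjSL_mul_self A
    simp [conjPSL, h]

/-- `SL(2, ℂ) ⋊ Z2`, where the generator of `Z2` acts by complex conjugation. -/
abbrev Gtilde : Type := SL(2, ℂ) ⋊[involutionAction conjSL conjSL_mul_self] Z2

/-- `G = Isom(ℍ³)`, in the upper half-space model `PSL(2, ℂ) ⋊ Z2`, where the generator `c`
of `Z2` acts by complex conjugation. -/
abbrev G : Type := PSL(2, ℂ) ⋊[involutionAction conjPSL conjPSL_mul_self] Z2

/-- The topology of `G` is the product topology of `PSL(2, ℂ) × Z2`. -/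
instance : TopologicalSpace G :=
  TopologicalSpace.induced SemidirectProduct.equivProd inferInstance

/-- The two-fold covering `SL(2, ℂ) ⋊ Z2 → PSL(2, ℂ) ⋊ Z2`. -/
def cover : Gtilde →* G :=
  SemidirectProduct.map (QuotientGroup.mk' (Subgroup.center SL(2, ℂ))) (MonoidHom.id Z2) (by
    intro ε
    ext A
    by_cases h : ε = 1 <;> simp [involutionAction, h, conjPSL])

/-- The set `G₋` of orientation reversing isometries. -/
def Gminus : Set G := {g | g.right ≠ 1}

theorem center_mul_action (ε : Z2) {z : SL(2, ℂ)} (hz : z ∈ Subgroup.center SL(2, ℂ)) :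
    z * involutionAction conjSL conjSL_mul_self ε z = 1 := by
  obtain ⟨r, hr, hz⟩ := Matrix.SpecialLinearGroup.mem_center_iff.1 hz
  have hr' : r = 1 ∨ r = -1 := by simpa using hr
  by_cases h : ε = 1
  · ext i j
    fin_cases i <;> fin_cases j <;> rcases hr' with rfl | rfl <;>
      simp [involutionAction, h, ← hz]
  · ext i j
    fin_cases i <;> fin_cases j <;> rcases hr' with rfl | rfl <;>
      simp [involutionAction, h, conjSL, ← hz]

/-- The square map `Q : G → SL(2, ℂ)`: `Q([A]) = A²` on orientation preserving isometries and
`Q([A] c) = A Ā` on orientation reversing ones. -/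
def Q (g : G) : SL(2, ℂ) :=
  Quotient.liftOn' g.left
    (fun A => A * involutionAction conjSL conjSL_mul_self g.right A) (by
      intro A B hAB
      have hz : A⁻¹ * B ∈ Subgroup.center SL(2, ℂ) := QuotientGroup.leftRel_apply.1 hAB
      obtain ⟨z, rfl⟩ : ∃ z, B = A * z := ⟨A⁻¹ * B, by group⟩
      rw [inv_mul_cancel_left] at hz
      have h := center_mul_action g.right hz
      have hc := Subgroup.mem_center_iff.1 hz
      simp only [map_mul]
      rw [mul_assoc A z, ← mul_assoc z, ← hc, mul_assoc _ z, h, mul_one])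

/-- The lifted relator `(A₁, …, Aₙ) ↦ Q(A₁) ⋯ Q(Aₙ)`. -/
def liftedRelator {n : ℕ} (A : Fin n → G) : SL(2, ℂ) := (List.ofFn fun i => Q (A i)).prod

/-- `Xₙ(C)`, the `n`-tuples in `G₋` with `Q(A₁) ⋯ Q(Aₙ) = C`. -/
def X (n : ℕ) (C : SL(2, ℂ)) : Set (Fin n → G) :=
  {A | (∀ i, A i ∈ Gminus) ∧ liftedRelator A = C}

/-- `X'ₙ(C)`, the tuples in `Xₙ(C)` for which some `Q(Aᵢ)`, `Q(Aⱼ)` do not commute. -/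
def X' (n : ℕ) (C : SL(2, ℂ)) : Set (Fin n → G) :=
  {A | A ∈ X n C ∧ ∃ i j, ⁅Q (A i), Q (A j)⁆ ≠ 1}

/-- The word `a₁² ⋯ aₙ²`. -/
def relator (n : ℕ) : FreeGroup (Fin n) := (List.ofFn fun i => FreeGroup.of i ^ 2).prod

/-- `π₁(Nₙ) = ⟨a₁, …, aₙ ∣ a₁² ⋯ aₙ² = 1⟩`, the fundamental group of the closed non-orientable
surface of genus `n`. -/
abbrev piN (n : ℕ) : Type := PresentedGroup ({relator n} : Set (FreeGroup (Fin n)))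

/-- The orientation character of `Nₙ`: each generator `aᵢ` is a one-sided (orientation reversing)
loop. A class is orientation reversing when its value is not `1`. -/
def orientationChar (n : ℕ) : piN n →* Z2 :=
  PresentedGroup.toGroup (f := fun _ => Multiplicative.ofAdd 1) (by
    intro r hr
    rw [Set.mem_singleton_iff.1 hr, relator, map_list_prod, List.map_ofFn]
    apply List.prod_eq_one
    intro x hx
    obtain ⟨i, rfl⟩ := List.mem_ofFn.1 hx
    simp only [Function.comp_apply, map_pow, FreeGroup.lift_apply_of]
    decide)

/-- `hom^tp(π₁(Nₙ), G)`, the representations that preserve the orientation type. -/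
def HomTP (n : ℕ) : Type :=
  {φ : piN n →* G // ∀ γ, φ γ ∈ Gminus ↔ orientationChar n γ ≠ 1}

/-- The topology of pointwise convergence. -/
instance (n : ℕ) : TopologicalSpace (HomTP n) :=
  TopologicalSpace.induced (fun φ => (φ.1 : piN n → G)) inferInstance

/-- The images of the standard generators. -/
def onGenerators {n : ℕ} (φ : HomTP n) : Fin n → G := fun i => φ.1 (PresentedGroup.of i)

open Classical in
/-- The second Stiefel-Whitney class `w₂(φ) ∈ H²(Nₙ; ℤ/2) = ℤ/2`, as the obstruction class given
by the lifted relator, which takes the values `1` (class `0`) and `-1` (class `1`). -/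
def w2 {n : ℕ} (φ : HomTP n) : ZMod 2 := if liftedRelator (onGenerators φ) = 1 then 0 else 1

end IsomH3

end

/-! The squares `Q (A i)` carry the whole problem. Off `±1`, a matrix has the form `A Ā` exactly
when its trace is real and greater than `-2`. Indeed, after twisted conjugation the solutions of `A
Ā = companion τ` form the real conic `(2 + τ)u² + (τ - 2)v² = 1`, which is non-empty only for `τ >
-2`. When this conic is disconnected, `A ↦ -A` exchanges its two pieces, so the fibre in `G` is
connected (`isConnected_fibre`). Near a non-central value, `A ↦ A Ā` is moreover open onto the
matrices of real trace (`exists_near_lift`). In a non-commuting triple with central product no entry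
is central, so connectedness of `X'₃(±1)` follows from that of `squares`, the space of triples of
squares (`isPreconnected_of_fibres`).

For `squares`, take an eigenvector of the third matrix that is not an eigenvector of the first. In a
suitable basis the triple becomes an explicit normal form, parametrised by two traces and the
logarithm of an eigenvalue. The parameter space is connected and so is `SL(2, ℂ)`. If the
construction fails for a triple and for both its cyclic shifts, all three matrices have the same
eigenvectors and commute. Hence three connected pieces with a common point cover `squares`
(`isConnected_squares`).

Density is proved according to the number of central squares, which cannot be two. With none, the
commuting squares are triangular and are deformed explicitly, then lifted by openness. At a central
square openness fails; there `[P] c` is bent along `ξ` in the Lie algebra of its centralizer, and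
its square moves in the direction `ξ`. With one central square, bending it breaks commutation
(`mem_closure_of_one_central`). With three, bending two of them oppositely along a common `ξ` keeps
the product and leads to the previous case (`mem_closure_of_central`).

Finally, `Q g` is a lift of `g²` independent of choices, so type-preserving representations are
exactly the points of `X₃(1)` and `X₃(-1)`. These two sets are connected, and `w₂` separates them
continuously. -/

noncomputable section

namespace IsomH3

open Topology Filter

/-! ### The topological group `G` and continuity of the square map -/

/-- The generator of `Z2`. -/
abbrev flip : Z2 := Multiplicative.ofAdd 1

theorem flip_ne_one : flip ≠ 1 := by decide

theorem eq_flip_of_ne_one : ∀ {x : Z2}, x ≠ 1 → x = flip := by decide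

theorem eq_one_or_flip : ∀ x : Z2, x = 1 ∨ x = flip := by decide

theorem flip_mul_flip : flip * flip = 1 := by decide

/-- The orientation reversing isometry `[A] c`. -/
def refl (A : SL(2, ℂ)) : G := ⟨QuotientGroup.mk A, flip⟩

theorem refl_mem (A : SL(2, ℂ)) : refl A ∈ Gminus := flip_ne_one

theorem exists_refl {g : G} (hg : g ∈ Gminus) : ∃ A, g = refl A := by
  obtain ⟨A, hA⟩ := QuotientGroup.mk_surjective g.left
  exact ⟨A, SemidirectProduct.ext hA.symm (eq_flip_of_ne_one hg)⟩

theorem involutionAction_one {H : Type*} [Group H] (σ : MulAut H) (hσ : σ * σ = 1) :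
    involutionAction σ hσ 1 = 1 := map_one _

theorem involutionAction_flip {H : Type*} [Group H] (σ : MulAut H) (hσ : σ * σ = 1) :
    involutionAction σ hσ flip = σ :=
  if_neg (t := (1 : MulAut H)) (e := σ) flip_ne_one

theorem Q_refl (A : SL(2, ℂ)) : Q (refl A) = A * conjSL A := by
  change A * involutionAction conjSL conjSL_mul_self flip A = _
  rw [involutionAction_flip]

theorem conjSL_apply (A : SL(2, ℂ)) (i j : Fin 2) :
    (conjSL A).1 i j = starRingEnd ℂ (A.1 i j) := rfl

theorem conjSL_conjSL (A : SL(2, ℂ)) : conjSL (conjSL A) = A :=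
  DFunLike.congr_fun conjSL_mul_self A

theorem continuous_conjSL : Continuous conjSL := by
  refine continuous_induced_rng.2 ?_
  refine continuous_matrix fun i j => ?_
  exact Complex.continuous_conj.comp (continuous_subtype_val.matrix_elem i j)

theorem continuous_conjPSL : Continuous conjPSL := by
  refine QuotientGroup.isOpenQuotientMap_mk.isQuotientMap.continuous_iff.2 ?_
  exact QuotientGroup.continuous_mk.comp continuous_conjSL

theorem continuous_left : Continuous (fun g : G => g.left) :=
  continuous_fst.comp (continuous_induced_dom (f := SemidirectProduct.equivProd))

theorem continuous_right : Continuous (fun g : G => g.right) :=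
  continuous_snd.comp (continuous_induced_dom (f := SemidirectProduct.equivProd))

theorem continuous_G_iff {α : Type*} [TopologicalSpace α] {f : α → G} :
    Continuous f ↔ Continuous (fun a => (f a).left) ∧ Continuous (fun a => (f a).right) := by
  rw [continuous_induced_rng]
  exact continuous_prodMk

theorem continuous_refl : Continuous refl :=
  continuous_G_iff.2 ⟨QuotientGroup.continuous_mk, continuous_const⟩

/-- `Z2` is discrete, so continuity can be checked for each value of `e` separately. This handles
the twisted product, the inverse and `Q`. -/
theorem continuous_piecewise_Z2 {α β : Type*} [TopologicalSpace α] [TopologicalSpace β]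
    {e : α → Z2} (he : Continuous e) {f : α → β} {p : Z2 → α → β} (hp : ∀ ε, Continuous (p ε))
    (hf : ∀ a, f a = p (e a) a) : Continuous f := by
  have h : f = (fun q : Z2 × α => p q.1 q.2) ∘ fun a => (e a, a) := funext hf
  rw [h]
  refine Continuous.comp ?_ (he.prodMk continuous_id)
  exact continuous_prod_of_discrete_left.2 hp

theorem continuous_involutionAction {H : Type*} [Group H] [TopologicalSpace H] (σ : MulAut H)
    (hσ : σ * σ = 1) (hc : Continuous σ) (ε : Z2) : Continuous (involutionAction σ hσ ε) := by
  rcases eq_one_or_flip ε with rfl | rfl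
  · rw [involutionAction_one]; exact continuous_id
  · rw [involutionAction_flip]; exact hc

instance : IsTopologicalGroup G where
  continuous_mul := by
    refine continuous_G_iff.2 ⟨?_, ?_⟩
    · refine continuous_piecewise_Z2 (e := fun q : G × G => q.1.right)
        (p := fun ε q => q.1.left * involutionAction conjPSL conjPSL_mul_self ε q.2.left)
        (continuous_right.comp continuous_fst) (fun ε => ?_) (fun q => rfl)
      exact (continuous_left.comp continuous_fst).mul
        ((continuous_involutionAction _ _ continuous_conjPSL ε).comp
          (continuous_left.comp continuous_snd))
    · exact (continuous_right.comp continuous_fst).mul (continuous_right.comp continuous_snd)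
  continuous_inv := by
    refine continuous_G_iff.2 ⟨?_, ?_⟩
    · refine continuous_piecewise_Z2 (e := fun q : G => q.right)
        (p := fun ε q => involutionAction conjPSL conjPSL_mul_self ε⁻¹ q.left⁻¹)
        continuous_right (fun ε => ?_) (fun q => rfl)
      exact (continuous_involutionAction _ _ continuous_conjPSL _).comp continuous_left.inv
    · exact continuous_right.inv

theorem continuous_Q : Continuous Q := by
  let F : Z2 → PSL(2, ℂ) → SL(2, ℂ) := fun ε x => Q ⟨x, ε⟩
  refine continuous_piecewise_Z2 (e := fun g : G => g.right) (p := fun ε g => F ε g.left)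
    continuous_right (fun ε => ?_) (fun g => rfl)
  have hF : Continuous (F ε) := by
    refine QuotientGroup.isOpenQuotientMap_mk.isQuotientMap.continuous_iff.2 ?_
    exact continuous_id.mul (continuous_involutionAction _ _ continuous_conjSL ε)
  exact hF.comp continuous_left

theorem continuous_liftedRelator {n : ℕ} :
    Continuous (liftedRelator : (Fin n → G) → SL(2, ℂ)) := by
  have : (liftedRelator : (Fin n → G) → SL(2, ℂ)) =
      fun A => ((List.finRange n).map fun i => Q (A i)).prod := by
    funext A
    rw [liftedRelator, List.ofFn_eq_map]
  rw [this]
  exact continuous_list_prod _ fun i _ => continuous_Q.comp (continuous_apply i)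

theorem liftedRelator_three (A : Fin 3 → G) :
    liftedRelator A = Q (A 0) * Q (A 1) * Q (A 2) := by
  simp [liftedRelator, List.ofFn_succ, mul_assoc]

/-! ### The center and the entries of `SL(2, ℂ)` -/

theorem mem_center_iff {A : SL(2, ℂ)} : A ∈ Subgroup.center SL(2, ℂ) ↔ A = 1 ∨ A = -1 := by
  constructor
  · intro h
    obtain ⟨r, hr, hz⟩ := Matrix.SpecialLinearGroup.mem_center_iff.1 h
    have hr' : r = 1 ∨ r = -1 := by simpa using hr
    rcases hr' with rfl | rfl
    · left; ext i j; fin_cases i <;> fin_cases j <;> simp [← hz]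
    · right; ext i j; fin_cases i <;> fin_cases j <;> simp [← hz]
  · rintro (rfl | rfl)
    · exact one_mem _
    · refine Subgroup.mem_center_iff.2 fun g => ?_
      ext i j; simp

theorem mk_eq_one_iff {A : SL(2, ℂ)} :
    (QuotientGroup.mk A : PSL(2, ℂ)) = 1 ↔ A = 1 ∨ A = -1 := by
  rw [QuotientGroup.eq_one_iff, mem_center_iff]

theorem refl_neg (A : SL(2, ℂ)) : refl (-A) = refl A := by
  refine SemidirectProduct.ext ?_ rfl
  refine (QuotientGroup.eq).2 (mem_center_iff.2 (Or.inr ?_))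
  ext i j; simp [inv_neg]

theorem SL_ext {A B : SL(2, ℂ)} (h00 : A.1 0 0 = B.1 0 0) (h01 : A.1 0 1 = B.1 0 1)
    (h10 : A.1 1 0 = B.1 1 0) (h11 : A.1 1 1 = B.1 1 1) : A = B := by
  ext i j
  fin_cases i <;> fin_cases j <;> assumption

theorem mul_00 (A B : SL(2, ℂ)) :
    (A * B).1 0 0 = A.1 0 0 * B.1 0 0 + A.1 0 1 * B.1 1 0 := by
  simp [Matrix.mul_apply, Fin.sum_univ_two]

theorem mul_01 (A B : SL(2, ℂ)) :
    (A * B).1 0 1 = A.1 0 0 * B.1 0 1 + A.1 0 1 * B.1 1 1 := by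
  simp [Matrix.mul_apply, Fin.sum_univ_two]

theorem mul_10 (A B : SL(2, ℂ)) :
    (A * B).1 1 0 = A.1 1 0 * B.1 0 0 + A.1 1 1 * B.1 1 0 := by
  simp [Matrix.mul_apply, Fin.sum_univ_two]

theorem mul_11 (A B : SL(2, ℂ)) :
    (A * B).1 1 1 = A.1 1 0 * B.1 0 1 + A.1 1 1 * B.1 1 1 := by
  simp [Matrix.mul_apply, Fin.sum_univ_two]

theorem det_SL (A : SL(2, ℂ)) : A.1 0 0 * A.1 1 1 - A.1 0 1 * A.1 1 0 = 1 := by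
  rw [← Matrix.det_fin_two]; exact A.2

theorem inv_coe (A : SL(2, ℂ)) :
    (A⁻¹).1 = !![A.1 1 1, -A.1 0 1; -A.1 1 0, A.1 0 0] := by
  rw [Matrix.SpecialLinearGroup.SL2_inv_expl]
  rfl

theorem inv_00 (A : SL(2, ℂ)) : (A⁻¹).1 0 0 = A.1 1 1 := by rw [inv_coe]; rfl

theorem inv_01 (A : SL(2, ℂ)) : (A⁻¹).1 0 1 = -A.1 0 1 := by rw [inv_coe]; rfl

theorem inv_10 (A : SL(2, ℂ)) : (A⁻¹).1 1 0 = -A.1 1 0 := by rw [inv_coe]; rfl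

theorem inv_11 (A : SL(2, ℂ)) : (A⁻¹).1 1 1 = A.1 0 0 := by rw [inv_coe]; rfl

/-- The element of `SL(2, ℂ)` with given entries. -/
def mk2 (a b c d : ℂ) (h : a * d - b * c = 1) : SL(2, ℂ) :=
  ⟨!![a, b; c, d], by rw [Matrix.det_fin_two_of]; exact h⟩

section mk2

variable (a b c d : ℂ) (h : a * d - b * c = 1)

theorem mk2_00 : (mk2 a b c d h).1 0 0 = a := rfl

theorem mk2_01 : (mk2 a b c d h).1 0 1 = b := rfl

theorem mk2_10 : (mk2 a b c d h).1 1 0 = c := rfl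

theorem mk2_11 : (mk2 a b c d h).1 1 1 = d := rfl

end mk2

/-! ### Cyclic vectors and companion matrices -/

/-- The trace of an element of `SL(2, ℂ)`. -/
def tr (A : SL(2, ℂ)) : ℂ := A.1 0 0 + A.1 1 1

theorem tr_mul_comm (A B : SL(2, ℂ)) : tr (A * B) = tr (B * A) := by
  simp only [tr, mul_00, mul_11]; ring

theorem tr_conj (g A : SL(2, ℂ)) : tr (g * A * g⁻¹) = tr A := by
  rw [tr_mul_comm, inv_mul_cancel_left]

theorem tr_conjSL (A : SL(2, ℂ)) : tr (conjSL A) = starRingEnd ℂ (tr A) := by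
  simp [tr, conjSL_apply]

/-- The companion matrix of `X² - x X + 1`. -/
def companion (x : ℂ) : SL(2, ℂ) := mk2 x (-1) 1 0 (by simp)

theorem eq_one_or_eq_neg_one {B : SL(2, ℂ)} (e1 : B.1 1 0 = 0) (e2 : B.1 0 1 = 0)
    (e3 : B.1 0 0 = B.1 1 1) : B = 1 ∨ B = -1 := by
  have hdet := det_SL B
  rw [e1, e2, e3] at hdet
  have : (B.1 1 1 - 1) * (B.1 1 1 + 1) = 0 := by linear_combination hdet
  rcases mul_eq_zero.1 this with h | h
  · have h' : B.1 1 1 = 1 := by linear_combination h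
    exact Or.inl (SL_ext (by simp [e3, h']) (by simp [e2]) (by simp [e1]) (by simp [h']))
  · have h' : B.1 1 1 = -1 := by linear_combination h
    exact Or.inr (SL_ext (by simp [e3, h']) (by simp [e2]) (by simp [e1]) (by simp [h']))

/-- The quadratic form vanishing on the eigenvectors of `A`. -/
def eigenForm (A : SL(2, ℂ)) (u v : ℂ) : ℂ :=
  u * (A.1 1 0 * u - A.1 0 0 * v) - (-A.1 1 1 * u + A.1 0 1 * v) * v

/-- With `w = (u, v)`, `eigenForm B u v` is the determinant of `(w, B w)` and also of `(w, -B⁻¹ w)`.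
In the latter basis `B` is a companion matrix by Cayley–Hamilton, and dividing by a square root `d`
of the determinant gives `g` determinant one. The relation between `w` and the first column of `g`
is recorded for the normal form of triples. -/
theorem exists_companion_of_eigenForm {B : SL(2, ℂ)} {u v : ℂ} (h : eigenForm B u v ≠ 0) :
    ∃ (g : SL(2, ℂ)) (d : ℂ), d ≠ 0 ∧ d * g.1 0 0 = u ∧ d * g.1 1 0 = v ∧
      B = g * companion (tr B) * g⁻¹ := by
  have hdet := det_SL B
  obtain ⟨d, hd⟩ := IsAlgClosed.exists_pow_nat_eq (eigenForm B u v) two_pos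
  have hd0 : d ≠ 0 := by
    rintro rfl
    exact h (by rw [← hd]; ring)
  simp only [eigenForm] at hd
  refine ⟨mk2 (u / d) ((-B.1 1 1 * u + B.1 0 1 * v) / d)
    (v / d) ((B.1 1 0 * u - B.1 0 0 * v) / d) ?_, d, hd0, ?_, ?_, ?_⟩
  · field_simp
    linear_combination -hd
  · rw [mk2_00]; field_simp
  · rw [mk2_10]; field_simp
  · rw [eq_mul_inv_iff_mul_eq]
    apply SL_ext <;> simp only [mul_00, mul_01, mul_10, mul_11, companion, tr,
      mk2_00, mk2_01, mk2_10, mk2_11]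
    · field_simp; ring
    · field_simp; linear_combination (-u) * hdet
    · field_simp; ring
    · field_simp; linear_combination (-v) * hdet

/-- One of `(1, 0)`, `(0, 1)`, `(1, 1)` is cyclic: a matrix having all three as eigenvectors is
scalar. -/
theorem exists_companion {B : SL(2, ℂ)} (h1 : B ≠ 1) (h2 : B ≠ -1) :
    ∃ g : SL(2, ℂ), B = g * companion (tr B) * g⁻¹ := by
  have hdet := det_SL B
  have key : ∀ u v : ℂ, eigenForm B u v ≠ 0 → ∃ g : SL(2, ℂ), B = g * companion (tr B) * g⁻¹ := by
    intro u v hD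
    obtain ⟨g, -, -, -, -, hg⟩ := exists_companion_of_eigenForm hD
    exact ⟨g, hg⟩
  simp only [eigenForm] at key
  by_contra hne
  have e1 : B.1 1 0 = 0 := by
    by_contra h
    exact hne (key 1 0 (by simpa using h))
  have e2 : B.1 0 1 = 0 := by
    by_contra h
    exact hne (key 0 1 (by simpa using h))
  have e3 : B.1 0 0 = B.1 1 1 := by
    by_contra h
    refine hne (key 1 1 ?_)
    rw [e1, e2]
    intro h'
    exact h (by linear_combination -h')
  exact (eq_one_or_eq_neg_one e1 e2 e3).elim h1 h2

/-! ### Fibres of the square map over non-central elements -/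

/-- Twisted conjugation preserves the equation `A Ā = B`. -/
theorem twist_mul_conj (g A : SL(2, ℂ)) :
    g * A * (conjSL g)⁻¹ * conjSL (g * A * (conjSL g)⁻¹) = g * (A * conjSL A) * g⁻¹ := by
  simp only [map_mul, map_inv, conjSL_conjSL]
  group

/-- The solutions of `A Ā = companion τ`. -/
def conicSL (τ u v : ℝ) (h : (2 + τ) * u ^ 2 + (τ - 2) * v ^ 2 = 1) : SL(2, ℂ) :=
  mk2 ⟨u + u * τ, v - v * τ⟩ ⟨-u, v⟩ ⟨u, -v⟩ ⟨u, v⟩ (by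
    apply Complex.ext
    · simp only [Complex.sub_re, Complex.mul_re, Complex.one_re]; linear_combination h
    · simp only [Complex.sub_im, Complex.mul_im, Complex.one_im]; ring)

theorem conicSL_mul_conj (τ u v : ℝ) (h : (2 + τ) * u ^ 2 + (τ - 2) * v ^ 2 = 1) :
    conicSL τ u v h * conjSL (conicSL τ u v h) = companion τ := by
  apply SL_ext <;> simp only [mul_00, mul_01, mul_10, mul_11, conjSL_apply] <;>
    simp only [conicSL, companion, mk2_00, mk2_01, mk2_10, mk2_11] <;>
    apply Complex.ext <;> simp
  · linear_combination τ * h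
  · ring
  · linear_combination -h
  · ring
  · linear_combination h
  · ring
  · ring

theorem conicSL_neg (τ u v : ℝ) (h hh) : conicSL τ (-u) (-v) h = -conicSL τ u v hh := by
  apply SL_ext <;> apply Complex.ext <;>
    simp [conicSL, mk2_00, mk2_01, mk2_10, mk2_11] <;> ring

/-- The companion matrix `K` is real, so `A` commutes with it and `A = c K + d`. Then `Ā = A⁻¹ K`
forces `d = c̄`. With `c = u - i v`, `det A = 1` is the equation of the conic. -/
theorem exists_conicSL {A : SL(2, ℂ)} {τ : ℝ} (h : A * conjSL A = companion τ) :
    ∃ u v : ℝ, ∃ hh, A = conicSL τ u v hh := by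
  have hK : conjSL (companion τ) = companion τ := by
    apply SL_ext <;> simp [conjSL_apply, companion, mk2_00, mk2_01, mk2_10, mk2_11]
  have hinv : conjSL A = A⁻¹ * companion τ := by rw [← h, inv_mul_cancel_left]
  have hcomm : A * companion τ = companion τ * A := by
    have h2 : conjSL A * A = companion τ := by
      rw [← hK, ← h, map_mul, conjSL_conjSL]
    nth_rewrite 1 [← h2]
    rw [← h, mul_assoc]
  have c1 := congrArg (fun M : SL(2, ℂ) => M.1 1 0) hcomm
  have c2 := congrArg (fun M : SL(2, ℂ) => M.1 1 1) hcomm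
  have c3 := congrArg (fun M : SL(2, ℂ) => M.1 1 0) hinv
  simp only [mul_10, mul_11, inv_10, inv_11, conjSL_apply, companion, mk2_00, mk2_01, mk2_10, mk2_11]
    at c1 c2 c3
  have hd := det_SL A
  have e1 : A.1 0 0 = A.1 1 0 * τ + A.1 1 1 := by linear_combination -c1
  have e2 : A.1 0 1 = -A.1 1 0 := by linear_combination -c2
  have e3 : A.1 1 1 = starRingEnd ℂ (A.1 1 0) := by rw [c3]; linear_combination -e1
  have e4 : A.1 1 0 = ⟨(A.1 1 0).re, (A.1 1 0).im⟩ := rfl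
  have hh : (2 + τ) * (A.1 1 0).re ^ 2 + (τ - 2) * (-(A.1 1 0).im) ^ 2 = 1 := by
    rw [e1, e2, e3] at hd
    have := congrArg Complex.re hd
    simp at this
    linear_combination this
  refine ⟨(A.1 1 0).re, -(A.1 1 0).im, hh, ?_⟩
  apply SL_ext <;> simp only [conicSL, mk2_00, mk2_01, mk2_10, mk2_11]
  · rw [e1, e3]
    apply Complex.ext <;> simp <;> ring
  · rw [e2]
    apply Complex.ext <;> simp
  · apply Complex.ext <;> simp
  · rw [e3]
    apply Complex.ext <;> simp

/-- A real trace greater than `-2`. -/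
def GoodTrace (B : SL(2, ℂ)) : Prop := (tr B).im = 0 ∧ -2 < (tr B).re

theorem GoodTrace.conj {B : SL(2, ℂ)} (h : GoodTrace B) (g : SL(2, ℂ)) :
    GoodTrace (g * B * g⁻¹) := by
  rw [GoodTrace, tr_conj]; exact h

theorem tr_mul_conjSL_im (A : SL(2, ℂ)) : (tr (A * conjSL A)).im = 0 := by
  rw [← Complex.conj_eq_iff_im, ← tr_conjSL, map_mul, conjSL_conjSL, tr_mul_comm]

/-- Twisted conjugation reduces to `A Ā = companion τ`, and the conic has no real point for `τ ≤
-2`. -/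
theorem goodTrace_of_noncentral {A : SL(2, ℂ)} (h1 : A * conjSL A ≠ 1) (h2 : A * conjSL A ≠ -1) :
    GoodTrace (A * conjSL A) := by
  obtain ⟨g, hg⟩ := exists_companion h1 h2
  have him := tr_mul_conjSL_im A
  refine ⟨him, ?_⟩
  set τ := (tr (A * conjSL A)).re
  have hτ : tr (A * conjSL A) = τ := Complex.ext rfl (by simpa using him)
  rw [hτ] at hg
  have h3 := twist_mul_conj g⁻¹ A
  rw [hg] at h3
  have h4 : g⁻¹ * (g * companion τ * g⁻¹) * g⁻¹⁻¹ = companion τ := by group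
  rw [h4] at h3
  obtain ⟨u, v, hh, -⟩ := exists_conicSL h3
  nlinarith [sq_nonneg u, sq_nonneg v]

theorem companion_of_goodTrace {B : SL(2, ℂ)} (h1 : B ≠ 1) (h2 : B ≠ -1) (h : GoodTrace B) :
    ∃ (g : SL(2, ℂ)) (τ : ℝ), -2 < τ ∧ B = g * companion τ * g⁻¹ := by
  obtain ⟨g, hg⟩ := exists_companion h1 h2
  refine ⟨g, (tr B).re, h.2, ?_⟩
  have hτ : tr B = ((tr B).re : ℂ) := Complex.ext rfl (by simpa using h.1)
  rwa [hτ] at hg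

theorem conic_zero {τ : ℝ} (h : -2 < τ) :
    (2 + τ) * (1 / √(2 + τ)) ^ 2 + (τ - 2) * 0 ^ 2 = 1 := by
  have : 0 < 2 + τ := by linarith
  rw [div_pow, Real.sq_sqrt this.le]
  field_simp
  ring

theorem continuous_SL {α : Type*} [TopologicalSpace α] {f : α → SL(2, ℂ)}
    (h : ∀ i j, Continuous fun a => (f a).1 i j) : Continuous f :=
  continuous_induced_rng.2 (continuous_matrix h)

/-- The fibre of the square map on `G₋` over a non-central element is connected. -/
theorem isConnected_fibre {B : SL(2, ℂ)} (h1 : B ≠ 1) (h2 : B ≠ -1) (h : GoodTrace B) :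
    IsConnected {g | g ∈ Gminus ∧ Q g = B} := by
  obtain ⟨g, τ, hτ, rfl⟩ := companion_of_goodTrace h1 h2 h
  have hpos : 0 < 2 + τ := by linarith
  let F : SL(2, ℂ) → G := fun A => refl (g * A * (conjSL g)⁻¹)
  have hF : Continuous F :=
    continuous_refl.comp ((continuous_const.mul continuous_id).mul continuous_const)
  have hFmem : ∀ u v hh, F (conicSL τ u v hh) ∈ {x | x ∈ Gminus ∧ Q x = g * companion τ * g⁻¹} :=
    fun u v hh => ⟨refl_mem _, by rw [Q_refl, twist_mul_conj, conicSL_mul_conj]⟩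
  refine ⟨⟨_, hFmem _ 0 (conic_zero hτ)⟩, ?_⟩
  refine isPreconnected_of_forall (F (conicSL τ _ 0 (conic_zero hτ))) ?_
  rintro y ⟨hy, hQ⟩
  obtain ⟨A, rfl⟩ := exists_refl hy
  rw [Q_refl] at hQ
  have h3 := twist_mul_conj g⁻¹ A
  rw [hQ] at h3
  have h4 : g⁻¹ * (g * companion τ * g⁻¹) * g⁻¹⁻¹ = companion τ := by group
  rw [h4] at h3
  -- `A` and `-A` agree in `PSL(2, ℂ)`, so the half `u ≥ 0` of the conic suffices.
  obtain ⟨u, v, hh, hu, hA⟩ : ∃ u v hh, 0 ≤ u ∧ refl A = F (conicSL τ u v hh) := by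
    obtain ⟨u, v, hh, hA⟩ := exists_conicSL h3
    have hA' : refl A = F (conicSL τ u v hh) := by
      simp only [F, ← hA, map_inv]
      congr 1
      group
    rcases le_total 0 u with hu | hu
    · exact ⟨u, v, hh, hu, hA'⟩
    · refine ⟨-u, -v, by simpa using hh, neg_nonneg.2 hu, ?_⟩
      rw [hA', conicSL_neg τ u v _ hh]
      simp only [F]
      rw [← refl_neg]
      congr 1
      ext i j
      simp
  -- The path scales `v` by `s` and recovers `u` as the nonnegative root. The radicand is affine in
  -- `s²` and nonnegative at both ends.
  have hnn : ∀ s : unitInterval, 0 ≤ (1 - (τ - 2) * (s * v) ^ 2) / (2 + τ) := by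
    intro s
    refine div_nonneg ?_ hpos.le
    have hs := s.2.1
    have hs1 : (s : ℝ) ^ 2 ≤ 1 := pow_le_one₀ s.2.1 s.2.2
    have : 0 ≤ 1 - (τ - 2) * v ^ 2 := by nlinarith [sq_nonneg u]
    nlinarith [mul_nonneg (sq_nonneg (s : ℝ)) this]
  have hc : ∀ s : unitInterval, (2 + τ) * √((1 - (τ - 2) * (s * v) ^ 2) / (2 + τ)) ^ 2 +
      (τ - 2) * (s * v) ^ 2 = 1 := by
    intro s
    rw [Real.sq_sqrt (hnn s)]
    field_simp
    ring
  let p : unitInterval → SL(2, ℂ) := fun s =>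
    conicSL τ (√((1 - (τ - 2) * (s * v) ^ 2) / (2 + τ))) (s * v) (hc s)
  have hp : Continuous p := by
    have c1 : Continuous fun s : unitInterval => √((1 - (τ - 2) * (s * v) ^ 2) / (2 + τ)) := by
      fun_prop
    have c2 : Continuous fun s : unitInterval => (s : ℝ) * v := by fun_prop
    have hmk : ∀ a b : unitInterval → ℝ, Continuous a → Continuous b →
        Continuous fun s => (⟨a s, b s⟩ : ℂ) := fun a b ha hb =>
      Complex.equivRealProdCLM.symm.continuous.comp (ha.prodMk hb)
    refine continuous_SL fun i j => ?_
    fin_cases i <;> fin_cases j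
    · exact hmk _ _ (c1.add (c1.mul continuous_const)) (c2.sub (c2.mul continuous_const))
    · exact hmk _ _ c1.neg c2
    · exact hmk _ _ c1 c2.neg
    · exact hmk _ _ c1 c2
  refine ⟨Set.range (F ∘ p), ?_, ⟨0, ?_⟩, ⟨1, ?_⟩, isPreconnected_range (hF.comp hp)⟩
  · rintro _ ⟨s, rfl⟩
    exact hFmem _ _ _
  · simp [p]
  · rw [hA]
    have e : √((1 - (τ - 2) * v ^ 2) / (2 + τ)) = u := by
      rw [Real.sqrt_eq_iff_mul_self_eq (by simpa using hnn 1) hu]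
      field_simp
      linear_combination -hh
    simp [p, e]

/-! ### Local openness of the square map -/

/-- Entrywise conjugation of matrices. -/
abbrev cj : Matrix (Fin 2) (Fin 2) ℂ →+* Matrix (Fin 2) (Fin 2) ℂ :=
  (starRingEnd ℂ).mapMatrix

theorem conjSL_coe (A : SL(2, ℂ)) : (conjSL A).1 = cj A.1 := rfl

theorem cj_smul (c : ℂ) (M : Matrix (Fin 2) (Fin 2) ℂ) :
    cj (c • M) = starRingEnd ℂ c • cj M := by
  ext i j; simp

open Classical in
/-- Rescaling of an invertible matrix to determinant one. -/
def normSL (M : Matrix (Fin 2) (Fin 2) ℂ) : SL(2, ℂ) :=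
  if h : M.det = 0 then 1 else
    ⟨(M.det ^ (-(1 / 2) : ℂ)) • M, by
      rw [Matrix.det_smul, Fintype.card_fin, ← Complex.cpow_nat_mul]
      norm_num
      rw [Complex.cpow_neg_one, inv_mul_cancel₀ h]⟩

theorem coe_normSL {M : Matrix (Fin 2) (Fin 2) ℂ} (h : M.det ≠ 0) :
    (normSL M).1 = (M.det ^ (-(1 / 2) : ℂ)) • M := by
  exact congrArg Subtype.val (dif_neg h)

theorem coe_normSL_of_det {M : Matrix (Fin 2) (Fin 2) ℂ} (h : M.det = 1) :
    (normSL M).1 = M := by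
  rw [coe_normSL (by simp [h]), h, Complex.one_cpow, one_smul]

theorem normSL_coe (A : SL(2, ℂ)) : normSL A.1 = A := Subtype.ext (coe_normSL_of_det A.2)

theorem continuousAt_normSL {M : Matrix (Fin 2) (Fin 2) ℂ} (h : M.det ∈ Complex.slitPlane) :
    ContinuousAt normSL M := by
  have hi : IsInducing (Subtype.val : SL(2, ℂ) → Matrix (Fin 2) (Fin 2) ℂ) := ⟨rfl⟩
  refine hi.continuousAt_iff.2 ?_
  have hd : ContinuousAt (fun Z : Matrix (Fin 2) (Fin 2) ℂ => Z.det) M :=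
    continuous_id.matrix_det.continuousAt
  have hc : ContinuousAt (fun Z : Matrix (Fin 2) (Fin 2) ℂ => (Z.det ^ (-(1 / 2) : ℂ)) • Z) M :=
    (hd.cpow continuousAt_const h).smul continuousAt_id
  refine hc.congr ?_
  filter_upwards [hd.eventually_ne (Complex.slitPlane_ne_zero h)] with Z hZ
  exact (coe_normSL hZ).symm

theorem scalar_sq_eq_one {A B : SL(2, ℂ)} {k : ℂ} (h : A.1 = k • B.1) : k = 1 ∨ k = -1 := by
  have := congrArg Matrix.det h
  rw [Matrix.det_smul, A.2, B.2, Fintype.card_fin, mul_one] at this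
  have h' : (k - 1) * (k + 1) = 0 := by linear_combination -this
  rcases mul_eq_zero.1 h' with h' | h'
  · exact Or.inl (by linear_combination h')
  · exact Or.inr (by linear_combination h')

theorem coe_add_coe_inv (N : SL(2, ℂ)) : N.1 + (N⁻¹).1 = tr N • 1 := by
  rw [inv_coe]
  ext i j
  fin_cases i <;> fin_cases j <;> simp [tr, add_comm]

/-- For a companion matrix the elementary matrix `!![0, 1; 0, 0]` is a solution; conjugation gives
the general case. This `W` pins down the value at the base point of a continuous family of solutions
of `B X = X B̄`. -/
theorem exists_sylvester {D : SL(2, ℂ)} (h1 : D ≠ 1) (h2 : D ≠ -1) :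
    ∃ W : Matrix (Fin 2) (Fin 2) ℂ, D.1 * W - W * (D⁻¹).1 = 1 := by
  obtain ⟨g, hg⟩ := exists_companion h1 h2
  set K := companion (tr D) with hK
  have hW : K.1 * !![0, 1; 0, 0] - !![0, 1; 0, 0] * (K⁻¹).1 = 1 := by
    rw [inv_coe]
    ext i j
    fin_cases i <;> fin_cases j <;>
      simp [Matrix.mul_apply, hK, companion, mk2_00, mk2_01, mk2_10, mk2_11]
  have hgi : (g⁻¹).1 * g.1 = 1 := by
    rw [← Matrix.SpecialLinearGroup.coe_mul, inv_mul_cancel, Matrix.SpecialLinearGroup.coe_one]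
  have hgi' : g.1 * (g⁻¹).1 = 1 := by
    rw [← Matrix.SpecialLinearGroup.coe_mul, mul_inv_cancel, Matrix.SpecialLinearGroup.coe_one]
  refine ⟨g.1 * !![0, 1; 0, 0] * (g⁻¹).1, ?_⟩
  have hD : D.1 = g.1 * K.1 * (g⁻¹).1 := by rw [hg]; simp only [Matrix.SpecialLinearGroup.coe_mul]
  have hDi : (D⁻¹).1 = g.1 * (K⁻¹).1 * (g⁻¹).1 := by
    have : D⁻¹ = g * K⁻¹ * g⁻¹ := by rw [hg]; group
    rw [this]; simp only [Matrix.SpecialLinearGroup.coe_mul]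
  rw [hD, hDi]
  generalize (!![0, 1; 0, 0] : Matrix (Fin 2) (Fin 2) ℂ) = W at *
  calc _ = g.1 * K.1 * ((g⁻¹).1 * g.1) * W * (g⁻¹).1 -
      g.1 * W * ((g⁻¹).1 * g.1) * (K⁻¹).1 * (g⁻¹).1 := by noncomm_ring
    _ = g.1 * (K.1 * W - W * (K⁻¹).1) * (g⁻¹).1 := by rw [hgi]; noncomm_ring
    _ = 1 := by rw [hW, mul_one, hgi']

/-- If `B P = P B̄`, averaging `P` and `B P̄⁻¹` produces a multiple of a solution of `Y Ȳ = B`. -/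
theorem average_mul_conj {B P : SL(2, ℂ)} (h : B * P = P * conjSL B) :
    (P.1 + (B * (conjSL P)⁻¹).1) * cj (P.1 + (B * (conjSL P)⁻¹).1) =
      (tr ((P * conjSL P)⁻¹ * B) + 2) • B.1 := by
  set R := B * (conjSL P)⁻¹
  set N := (P * conjSL P)⁻¹ * B
  have e1 : P * conjSL P = B * N⁻¹ := by simp only [N]; group
  have e2 : R * conjSL P = B := by simp only [R]; group
  have e3 : P * conjSL R = B := by
    simp only [R, map_mul, map_inv, conjSL_conjSL]
    rw [← mul_assoc, ← h, mul_inv_cancel_right]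
  have e4 : R * conjSL R = B * N := by
    have : conjSL B * P⁻¹ = P⁻¹ * B := by
      rw [mul_inv_eq_iff_eq_mul, mul_assoc, h, inv_mul_cancel_left]
    simp only [R, N, map_mul, map_inv, conjSL_conjSL, this]
    group
  replace e1 := congrArg Subtype.val e1
  replace e2 := congrArg Subtype.val e2
  replace e3 := congrArg Subtype.val e3
  replace e4 := congrArg Subtype.val e4
  simp only [Matrix.SpecialLinearGroup.coe_mul, conjSL_coe] at e1 e2 e3 e4
  have e5 := coe_add_coe_inv N
  calc (P.1 + R.1) * cj (P.1 + R.1)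
      = P.1 * cj P.1 + R.1 * cj P.1 + P.1 * cj R.1 + R.1 * cj R.1 := by
        rw [map_add]; noncomm_ring
    _ = B.1 * (N.1 + (N⁻¹).1) + 2 * B.1 := by rw [e1, e2, e3, e4]; noncomm_ring
    _ = _ := by
      rw [e5, add_smul, mul_smul_comm, mul_one, two_mul, two_smul]

/-- The equation `A' Ā' = B` is solved through its linear consequence `B X = X B̄`, which has an
explicit solution depending continuously on `B`, because `B + B⁻¹` and `B̄ + B̄⁻¹` are the same
scalar when the trace is real. Normalizing, averaging and normalizing again gives `A' Ā' = ± B`, and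
continuity fixes the sign. -/
theorem exists_near_lift {A : SL(2, ℂ)} (h1 : A * conjSL A ≠ 1) (h2 : A * conjSL A ≠ -1)
    {U : Set SL(2, ℂ)} (hU : U ∈ 𝓝 A) :
    ∀ᶠ B in 𝓝 (A * conjSL A), (tr B).im = 0 → ∃ A' ∈ U, A' * conjSL A' = B := by
  set B₀ := A * conjSL A with hB₀
  have hD1 : conjSL B₀ ≠ 1 := fun h => h1 (by rw [← conjSL_conjSL B₀, h, map_one])
  have hD2 : conjSL B₀ ≠ -1 := fun h => h2 (by
    rw [← conjSL_conjSL B₀, h]; apply SL_ext <;> simp [conjSL_apply])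
  obtain ⟨W, hW⟩ := exists_sylvester hD1 hD2
  -- a solution of `B X = X B̄` depending continuously on `B`
  let X : SL(2, ℂ) → Matrix (Fin 2) (Fin 2) ℂ :=
    fun B => B.1 * (A.1 * W) - (A.1 * W) * ((conjSL B)⁻¹).1
  have hXc : Continuous X := by
    refine (continuous_subtype_val.matrix_mul continuous_const).sub
      (continuous_const.matrix_mul ?_)
    exact continuous_subtype_val.comp continuous_conjSL.inv
  have hX0 : X B₀ = A.1 := by
    have : B₀.1 * A.1 = A.1 * (conjSL B₀).1 := by
      rw [← Matrix.SpecialLinearGroup.coe_mul, ← Matrix.SpecialLinearGroup.coe_mul, hB₀, map_mul,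
        conjSL_conjSL, mul_assoc]
    calc X B₀ = B₀.1 * A.1 * W - A.1 * W * ((conjSL B₀)⁻¹).1 := by simp only [X]; noncomm_ring
      _ = A.1 * ((conjSL B₀).1 * W - W * ((conjSL B₀)⁻¹).1) := by rw [this]; noncomm_ring
      _ = A.1 := by rw [hW, mul_one]
  have hXB : ∀ B : SL(2, ℂ), (tr B).im = 0 → B.1 * X B = X B * (conjSL B).1 := by
    intro B hB
    have ht : tr (conjSL B) = tr B := by rw [tr_conjSL]; exact Complex.conj_eq_iff_im.2 hB
    have s1 := coe_add_coe_inv B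
    have s2 := coe_add_coe_inv (conjSL B)
    rw [ht, ← s1] at s2
    have i1 : B.1 * (B⁻¹).1 = 1 := by
      rw [← Matrix.SpecialLinearGroup.coe_mul, mul_inv_cancel, Matrix.SpecialLinearGroup.coe_one]
    have i2 : ((conjSL B)⁻¹).1 * (conjSL B).1 = 1 := by
      rw [← Matrix.SpecialLinearGroup.coe_mul, inv_mul_cancel, Matrix.SpecialLinearGroup.coe_one]
    have s3 : B.1 * (A.1 * W) + (B⁻¹).1 * (A.1 * W) =
        A.1 * W * (conjSL B).1 + A.1 * W * ((conjSL B)⁻¹).1 := by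
      rw [← add_mul, ← mul_add, s2, s1, smul_mul_assoc, one_mul, mul_smul_comm, mul_one]
    have s4 := congrArg (fun M => B.1 * M) s3
    have s5 : B.1 * ((B⁻¹).1 * (A.1 * W)) = A.1 * W * (((conjSL B)⁻¹).1 * (conjSL B).1) := by
      rw [← mul_assoc, i1, i2, one_mul, mul_one]
    simp only [mul_add, s5] at s4
    simp only [X, mul_sub, sub_mul]
    rw [sub_eq_sub_iff_add_eq_add]
    rw [mul_assoc (A.1 * W)]
    rw [mul_assoc B.1 (A.1 * W), s4]
  let P : SL(2, ℂ) → SL(2, ℂ) := fun B => normSL (X B)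
  have hP0 : P B₀ = A := by simp only [P, hX0, normSL_coe]
  have hPc : ContinuousAt P B₀ := by
    refine ContinuousAt.comp (continuousAt_normSL ?_) hXc.continuousAt
    rw [hX0, A.2]; exact Complex.one_mem_slitPlane
  -- The solutions of `P P̄ = B` are the fixed points of `P ↦ B P̄⁻¹`, hence the average. The factor
  -- `1 / 2` gives the value `A` at `B₀`.
  let Y : SL(2, ℂ) → Matrix (Fin 2) (Fin 2) ℂ :=
    fun B => (1 / 2 : ℂ) • ((P B).1 + (B * (conjSL (P B))⁻¹).1)
  have hY0 : Y B₀ = A.1 := by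
    have : B₀ * (conjSL A)⁻¹ = A := by rw [hB₀, mul_inv_cancel_right]
    simp only [Y, hP0, this]
    rw [← two_smul ℂ A.1, smul_smul]
    norm_num
  have hYc : ContinuousAt Y B₀ := by
    refine ContinuousAt.fun_const_smul (ContinuousAt.fun_add ?_ ?_) _
    · exact continuous_subtype_val.continuousAt.comp hPc
    · refine continuous_subtype_val.continuousAt.comp (continuousAt_id.mul ?_)
      exact (continuous_conjSL.continuousAt.comp hPc).inv
  let A' : SL(2, ℂ) → SL(2, ℂ) := fun B => normSL (Y B)
  have hA0 : A' B₀ = A := by simp only [A', hY0, normSL_coe]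
  have hAc : ContinuousAt A' B₀ := by
    refine ContinuousAt.comp (continuousAt_normSL ?_) hYc
    rw [hY0, A.2]; exact Complex.one_mem_slitPlane
  have ev1 : ∀ᶠ B in 𝓝 B₀, (X B).det ≠ 0 :=
    hXc.matrix_det.continuousAt.eventually_ne (by rw [hX0, A.2]; exact one_ne_zero)
  have ev2 : ∀ᶠ B in 𝓝 B₀, (Y B).det ≠ 0 :=
    (continuous_id.matrix_det.continuousAt.comp hYc).eventually_ne
      (by simp only [Function.comp, id, hY0, A.2]; exact one_ne_zero)
  -- Determinants only give `A' Ā' = ± B`; at `B₀` the sign is `+`, hence also nearby.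
  have ev3 : ∀ᶠ B in 𝓝 B₀, A' B * conjSL (A' B) * B⁻¹ ≠ -1 := by
    refine ((hAc.mul (continuous_conjSL.continuousAt.comp hAc)).mul
      continuousAt_id.inv).eventually_ne ?_
    simp only [Function.comp, id, Pi.mul_apply, Pi.inv_apply, hA0, ← hB₀, mul_inv_cancel]
    intro h
    have := congrArg (fun M : SL(2, ℂ) => M.1 0 0) h
    simp at this
    norm_num [Complex.ext_iff] at this
  have ev4 : ∀ᶠ B in 𝓝 B₀, A' B ∈ U := hAc.eventually_mem (by rwa [hA0])
  filter_upwards [ev1, ev2, ev3, ev4] with B b1 b2 b3 b4 hB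
  refine ⟨A' B, b4, ?_⟩
  have hP : B * P B = P B * conjSL B := by
    apply Subtype.ext
    simp only [Matrix.SpecialLinearGroup.coe_mul, P, coe_normSL b1, mul_smul_comm, smul_mul_assoc]
    rw [hXB B hB]
  have hk : ∃ k : ℂ, (A' B * conjSL (A' B)).1 = k • B.1 := by
    simp only [Matrix.SpecialLinearGroup.coe_mul, conjSL_coe, A', coe_normSL b2]
    rw [cj_smul, smul_mul_smul_comm]
    simp only [Y]
    rw [cj_smul, smul_mul_smul_comm, average_mul_conj hP, smul_smul, smul_smul]
    exact ⟨_, rfl⟩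
  obtain ⟨k, hk⟩ := hk
  rcases scalar_sq_eq_one hk with rfl | rfl
  · exact Subtype.ext (by rw [hk, one_smul])
  · refine absurd ?_ b3
    rw [mul_inv_eq_iff_eq_mul]
    apply Subtype.ext
    rw [hk]
    simp

/-! ### Triples of squares with central product -/

/-- `C` is the scalar matrix `ε = ± 1`. -/
def IsSign (C : SL(2, ℂ)) (ε : ℝ) : Prop := (C = 1 ∧ ε = 1) ∨ (C = -1 ∧ ε = -1)

namespace IsSign

variable {C : SL(2, ℂ)} {ε : ℝ}

theorem mul_self (h : IsSign C ε) : ε * ε = 1 := by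
  rcases h with ⟨-, rfl⟩ | ⟨-, rfl⟩ <;> norm_num

theorem mul_self_coe (h : IsSign C ε) : (ε : ℂ) * ε = 1 := by
  exact_mod_cast h.mul_self

theorem comm (h : IsSign C ε) (A : SL(2, ℂ)) : A * C = C * A := by
  rcases h with ⟨rfl, -⟩ | ⟨rfl, -⟩
  · simp
  · ext i j; simp

theorem apply (h : IsSign C ε) :
    C.1 0 0 = ε ∧ C.1 0 1 = 0 ∧ C.1 1 0 = 0 ∧ C.1 1 1 = ε := by
  rcases h with ⟨rfl, rfl⟩ | ⟨rfl, rfl⟩ <;> simp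

theorem inv (h : IsSign C ε) : C⁻¹ = C := by
  rcases h with ⟨rfl, -⟩ | ⟨rfl, -⟩
  · simp
  · ext i j; simp [inv_neg]

theorem mul {C' : SL(2, ℂ)} {ε' : ℝ} (h : IsSign C ε) (h' : IsSign C' ε') :
    IsSign (C * C') (ε * ε') := by
  rcases h with ⟨rfl, rfl⟩ | ⟨rfl, rfl⟩ <;> rcases h' with ⟨rfl, rfl⟩ | ⟨rfl, rfl⟩ <;>
    simp [IsSign]

theorem coe (h : IsSign C ε) : C.1 = (ε : ℂ) • (1 : Matrix (Fin 2) (Fin 2) ℂ) := by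
  rcases h with ⟨rfl, rfl⟩ | ⟨rfl, rfl⟩ <;> simp

end IsSign

/-- The values of `(Q(A₁), Q(A₂), Q(A₃))` on `X'₃(C)`. -/
def squares (C : SL(2, ℂ)) : Set (Fin 3 → SL(2, ℂ)) :=
  {B | B 0 * B 1 * B 2 = C ∧ (∀ i, GoodTrace (B i)) ∧ B 0 * B 1 ≠ B 1 * B 0}

/-- The cyclic shift of triples. -/
def shift {α : Type*} (B : Fin 3 → α) : Fin 3 → α := fun i => B (i + 1)

theorem shift_shift_shift {α : Type*} (B : Fin 3 → α) : shift (shift (shift B)) = B := by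
  funext i
  fin_cases i <;> rfl

theorem continuous_shift {α : Type*} [TopologicalSpace α] :
    Continuous (shift : (Fin 3 → α) → Fin 3 → α) :=
  continuous_pi fun i => continuous_apply (i + 1)

theorem shift_mem_squares {C : SL(2, ℂ)} {ε : ℝ} (hC : IsSign C ε) {B : Fin 3 → SL(2, ℂ)}
    (hB : B ∈ squares C) : shift B ∈ squares C := by
  obtain ⟨h1, h2, h3⟩ := hB
  refine ⟨?_, fun i => h2 _, ?_⟩
  · change B 1 * B 2 * B 0 = C
    have : B 1 * B 2 = (B 0)⁻¹ * C := by rw [← h1]; group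
    rw [this, mul_assoc, ← hC.comm, inv_mul_cancel_left]
  · change B 1 * B 2 ≠ B 2 * B 1
    intro h
    apply h3
    have e : B 0 = C * (B 1 * B 2)⁻¹ := by rw [← h1]; group
    have e2 : B 0 * B 1 = C * (B 2)⁻¹ := by rw [e]; group
    have e3 : B 1 * B 0 = C * (B 2)⁻¹ := by rw [e, h, ← mul_assoc, hC.comm]; group
    rw [e2, e3]

theorem conj_mem_squares {C : SL(2, ℂ)} {ε : ℝ} (hC : IsSign C ε) {B : Fin 3 → SL(2, ℂ)}
    (hB : B ∈ squares C) (g : SL(2, ℂ)) : (fun i => g * B i * g⁻¹) ∈ squares C := by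
  obtain ⟨h1, h2, h3⟩ := hB
  refine ⟨?_, fun i => (h2 i).conj g, fun h => h3 ?_⟩
  · calc _ = g * (B 0 * B 1 * B 2) * g⁻¹ := by group
      _ = C := by rw [h1, hC.comm, mul_inv_cancel_right]
  · have : g * (B 0 * B 1) * g⁻¹ = g * (B 1 * B 0) * g⁻¹ := by
      calc _ = g * B 0 * g⁻¹ * (g * B 1 * g⁻¹) := by group
        _ = _ := h
        _ = _ := by group
    simpa using this

/-! ### Connectedness of `SL(2, ℂ)` -/

section connectedSL

/-- Products of four transvections. -/
def transvections (z : Fin 4 → ℂ) : SL(2, ℂ) :=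
  mk2 1 (z 0) 0 1 (by simp) * mk2 1 0 (z 1) 1 (by simp) * mk2 1 (z 2) 0 1 (by simp) *
    mk2 1 0 (z 3) 1 (by simp)

theorem continuous_mk2 {α : Type*} [TopologicalSpace α] {a b c d : α → ℂ}
    (h : ∀ x, a x * d x - b x * c x = 1) (ha : Continuous a) (hb : Continuous b)
    (hc : Continuous c) (hd : Continuous d) :
    Continuous fun x => mk2 (a x) (b x) (c x) (d x) (h x) := by
  refine continuous_SL fun i j => ?_
  fin_cases i <;> fin_cases j <;> assumption

theorem continuous_transvections : Continuous transvections := by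
  refine ((Continuous.mul ?_ ?_).mul ?_).mul ?_ <;> refine continuous_mk2 _ ?_ ?_ ?_ ?_ <;> fun_prop

/-- Three transvections suffice when the lower left entry is nonzero. Otherwise the lower right
entry is nonzero, and one more transvection reduces to that case. -/
theorem surjective_transvections : Function.Surjective transvections := by
  have key : ∀ A : SL(2, ℂ), A.1 1 0 ≠ 0 →
      ∃ u v w, A = mk2 1 u 0 1 (by simp) * mk2 1 0 v 1 (by simp) * mk2 1 w 0 1 (by simp) := by
    intro A h
    have hd := det_SL A
    refine ⟨(A.1 0 0 - 1) / A.1 1 0, A.1 1 0, (A.1 1 1 - 1) / A.1 1 0, ?_⟩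
    apply SL_ext <;>
      simp only [mul_00, mul_01, mul_10, mul_11, mk2_00, mk2_01, mk2_10, mk2_11] <;> field_simp
    · ring
    · linear_combination -hd
    · ring
    · ring
  intro A
  by_cases h : A.1 1 0 = 0
  · have h' : (A * mk2 1 0 1 1 (by simp)).1 1 0 ≠ 0 := by
      simp only [mul_10, mk2_00, mk2_10, h]
      have hd := det_SL A
      intro h2
      rw [h, show A.1 1 1 = 0 by linear_combination h2] at hd
      simp at hd
    obtain ⟨u, v, w, e⟩ := key _ h'
    refine ⟨![u, v, w, -1], ?_⟩
    rw [eq_mul_inv_of_mul_eq e]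
    simp only [transvections, Matrix.cons_val]
    congr 1
    apply SL_ext <;> simp [inv_00, inv_01, inv_10, inv_11, mk2_00, mk2_01, mk2_10, mk2_11]
  · obtain ⟨u, v, w, e⟩ := key _ h
    refine ⟨![u, v, w, 0], ?_⟩
    rw [e]
    simp only [transvections, Matrix.cons_val]
    convert mul_one _
    apply SL_ext <;> simp [mk2_00, mk2_01, mk2_10, mk2_11]

theorem isPreconnected_SL : IsPreconnected (Set.univ : Set SL(2, ℂ)) := by
  rw [← surjective_transvections.range_eq]
  exact isPreconnected_range continuous_transvections

end connectedSL

/-! ### Normal forms of non-commuting triples -/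

/-- The logarithms of eigenvalues of matrices with real trace greater than `-2`. -/
def cross : Set ℂ := {ζ | ζ.im = 0 ∨ (ζ.re = 0 ∧ |ζ.im| < Real.pi)}

theorem isPreconnected_cross : IsPreconnected cross := by
  have : StarConvex ℝ (0 : ℂ) cross := by
    intro ζ hζ a b _ hb hab
    have hb1 : b ≤ 1 := by linarith
    rcases hζ with h | ⟨h1, h2⟩
    · left; simp [h]
    · right
      refine ⟨by simp [h1], ?_⟩
      simp only [smul_zero, zero_add, Complex.smul_im, smul_eq_mul, abs_mul, abs_of_nonneg hb]
      nlinarith [abs_nonneg ζ.im]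
  exact (this.isPathConnected (Or.inl rfl)).isConnected.isPreconnected

theorem exp_add_exp_neg {ζ : ℂ} (h : ζ ∈ cross) :
    (Complex.exp ζ + Complex.exp (-ζ)).im = 0 ∧
      -2 < (Complex.exp ζ + Complex.exp (-ζ)).re := by
  rcases h with h | ⟨h1, h2⟩
  · simp only [Complex.add_im, Complex.add_re, Complex.exp_im, Complex.exp_re, Complex.neg_im, h,
      neg_zero, Real.sin_zero, Real.cos_zero, mul_zero, add_zero, mul_one, true_and]
    linarith [Real.exp_pos ζ.re, Real.exp_pos (-ζ).re]
  · simp only [Complex.add_im, Complex.add_re, Complex.exp_im, Complex.exp_re, Complex.neg_im,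
      Complex.neg_re, h1, neg_zero, Real.exp_zero, Real.sin_neg, Real.cos_neg, one_mul]
    refine ⟨by ring, ?_⟩
    have : Real.cos Real.pi < Real.cos |ζ.im| :=
      Real.cos_lt_cos_of_nonneg_of_le_pi (abs_nonneg _) le_rfl h2
    rw [Real.cos_pi, Real.cos_abs] at this
    linarith

/-- A real value of `σ + σ⁻¹` forces `σ` to be real or of modulus one. The bound `-2` excludes the
negative reals, so the principal logarithm lies in `cross`. -/
theorem exists_cross {σ : ℂ} (h0 : σ ≠ 0) (him : (σ + σ⁻¹).im = 0) (hre : -2 < (σ + σ⁻¹).re) :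
    ∃ ζ ∈ cross, Complex.exp ζ = σ := by
  refine ⟨Complex.log σ, ?_, Complex.exp_log h0⟩
  have hn : 0 < Complex.normSq σ := Complex.normSq_pos.2 h0
  rw [Complex.add_im, Complex.inv_im] at him
  rw [Complex.add_re, Complex.inv_re] at hre
  have h : σ.im * (Complex.normSq σ - 1) = 0 := by
    field_simp at him
    linear_combination him
  rcases mul_eq_zero.1 h with h | h
  · left
    have hn' : Complex.normSq σ = σ.re * σ.re := by rw [Complex.normSq_apply, h]; ring
    have hre0 : σ.re ≠ 0 := by
      intro h'
      rw [hn', h'] at hn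
      simp at hn
    rw [Complex.log_im, Complex.arg_eq_zero_iff]
    refine ⟨?_, h⟩
    by_contra hneg
    push Not at hneg
    rw [hn'] at hre
    have e : σ.re / (σ.re * σ.re) = 1 / σ.re := by field_simp
    rw [e] at hre
    have e2 : (σ.re + 1 / σ.re) * σ.re = σ.re * σ.re + 1 := by field_simp
    nlinarith [mul_self_nonneg (σ.re + 1)]
  · right
    have hn1 : Complex.normSq σ = 1 := by linarith
    rw [hn1, div_one] at hre
    have hnorm : ‖σ‖ = 1 := by
      rw [Complex.normSq_eq_norm_sq] at hn1
      exact (pow_eq_one_iff_of_nonneg (norm_nonneg _) two_ne_zero).1 hn1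
    refine ⟨by rw [Complex.log_re, hnorm, Real.log_one], ?_⟩
    rw [Complex.log_im]
    refine lt_of_le_of_ne (Complex.abs_arg_le_pi σ) fun hp => ?_
    have : Real.cos σ.arg = -1 := by rw [← Real.cos_abs, hp, Real.cos_pi]
    rw [Complex.cos_arg h0, hnorm, div_one] at this
    linarith

section normalForm

variable {C : SL(2, ℂ)} {ε : ℝ}

/-- A normal form for generic triples in `squares C`, with traces `x`, `y` and with `exp ζ` an
eigenvalue of the third matrix. -/
def normalForm (hC : IsSign C ε) (p : (ℝ × ℝ) × ℂ) : Fin 3 → SL(2, ℂ) :=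
  ![companion p.1.1,
    mk2 0 (ε * Complex.exp p.2) (-(ε * Complex.exp (-p.2))) p.1.2 (by
      have := hC.mul_self_coe
      have h2 : Complex.exp p.2 * Complex.exp (-p.2) = 1 := by
        rw [← Complex.exp_add, add_neg_cancel, Complex.exp_zero]
      linear_combination (Complex.exp p.2 * Complex.exp (-p.2)) * this + h2),
    mk2 (Complex.exp p.2) (ε * p.1.2 - p.1.1 * Complex.exp p.2) 0 (Complex.exp (-p.2)) (by
      rw [mul_zero, sub_zero, ← Complex.exp_add, add_neg_cancel, Complex.exp_zero])]

theorem continuous_normalForm (hC : IsSign C ε) : Continuous (normalForm hC) := by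
  refine continuous_pi fun i => ?_
  have hx : Continuous fun p : (ℝ × ℝ) × ℂ => (p.1.1 : ℂ) := by fun_prop
  have hy : Continuous fun p : (ℝ × ℝ) × ℂ => (p.1.2 : ℂ) := by fun_prop
  have he : Continuous fun p : (ℝ × ℝ) × ℂ => Complex.exp p.2 := by fun_prop
  have he' : Continuous fun p : (ℝ × ℝ) × ℂ => Complex.exp (-p.2) := by fun_prop
  fin_cases i <;> refine continuous_SL fun i j => ?_ <;> fin_cases i <;> fin_cases j
  · exact hx
  · exact continuous_const
  · exact continuous_const
  · exact continuous_const
  · exact continuous_const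
  · exact continuous_const.mul he
  · exact (continuous_const.mul he').neg
  · exact hy
  · exact he
  · exact (continuous_const.mul hy).sub (hx.mul he)
  · exact continuous_const
  · exact he'

/-- The parameters of non-commuting normal forms. -/
def params (ε : ℝ) : Set ((ℝ × ℝ) × ℂ) :=
  {p | -2 < p.1.1 ∧ -2 < p.1.2 ∧ p.2 ∈ cross ∧ (p.2 = 0 → p.1.2 ≠ ε * p.1.1)}

/-- Only the line `y = ε x` in the slice `ζ = 0` is removed. The two sides `V₁ × cross` and `V₂ ×
cross` are joined through any full slice `V × {ζ}` with `ζ ≠ 0`. -/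
theorem isPreconnected_params (hC : IsSign C ε) : IsPreconnected (params ε) := by
  let V : Set (ℝ × ℝ) := {q | -2 < q.1 ∧ -2 < q.2}
  let V₁ : Set (ℝ × ℝ) := {q | (-2 < q.1 ∧ -2 < q.2) ∧ ε * q.1 < q.2}
  let V₂ : Set (ℝ × ℝ) := {q | (-2 < q.1 ∧ -2 < q.2) ∧ q.2 < ε * q.1}
  have cV : Convex ℝ V := (convex_Ioi (-2 : ℝ)).prod (convex_Ioi (-2 : ℝ))
  have cV₁ : Convex ℝ V₁ := by
    rintro ⟨a, b⟩ ⟨h1, h2⟩ ⟨c, d⟩ ⟨h3, h4⟩ s t hs ht hst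
    refine ⟨cV h1 h3 hs ht hst, ?_⟩
    have := convex_Ioi (0 : ℝ) (sub_pos.2 h2) (sub_pos.2 h4) hs ht hst
    simp only [Prod.smul_mk, Prod.mk_add_mk, smul_eq_mul, Set.mem_Ioi] at *
    linarith
  have cV₂ : Convex ℝ V₂ := by
    rintro ⟨a, b⟩ ⟨h1, h2⟩ ⟨c, d⟩ ⟨h3, h4⟩ s t hs ht hst
    refine ⟨cV h1 h3 hs ht hst, ?_⟩
    have := convex_Ioi (0 : ℝ) (sub_pos.2 h2) (sub_pos.2 h4) hs ht hst
    simp only [Prod.smul_mk, Prod.mk_add_mk, smul_eq_mul, Set.mem_Ioi] at *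
    linarith
  have hε : -2 < ε ∧ -2 < -ε := by
    rcases hC with ⟨-, rfl⟩ | ⟨-, rfl⟩ <;> norm_num
  have hεε := hC.mul_self
  have m₁ : (-ε, (0 : ℝ)) ∈ V₁ := ⟨⟨hε.2, by norm_num⟩, by simp only; linarith⟩
  have m₂ : (ε, (0 : ℝ)) ∈ V₂ := ⟨⟨hε.1, by norm_num⟩, by simp only; linarith⟩
  have h1c : (1 : ℂ) ∈ cross := Or.inl (by simp)
  have key : ∀ ζ ∈ cross, ζ ≠ 0 → IsPreconnected ((V₁ ×ˢ cross ∪ V ×ˢ {ζ}) ∪ V₂ ×ˢ cross) ∧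
      (V₁ ×ˢ cross ∪ V ×ˢ {ζ}) ∪ V₂ ×ˢ cross ⊆ params ε := by
    intro ζ hζ h0
    refine ⟨?_, ?_⟩
    · refine IsPreconnected.union (((ε, 0), ζ)) (Or.inr ⟨m₂.1, rfl⟩) ⟨m₂, hζ⟩
        (IsPreconnected.union (((-ε, 0), ζ)) ⟨m₁, hζ⟩ ⟨m₁.1, rfl⟩ ?_ ?_) ?_
      · exact cV₁.isPreconnected.prod isPreconnected_cross
      · exact cV.isPreconnected.prod isPreconnected_singleton
      · exact cV₂.isPreconnected.prod isPreconnected_cross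
    · rintro ⟨⟨x, y⟩, z⟩ ((⟨⟨⟨h1, h2⟩, h3⟩, h4⟩ | ⟨⟨h1, h2⟩, h4⟩) | ⟨⟨⟨h1, h2⟩, h3⟩, h4⟩)
      · exact ⟨h1, h2, h4, fun _ => h3.ne'⟩
      · obtain rfl : z = ζ := h4
        exact ⟨h1, h2, hζ, fun h => absurd h h0⟩
      · exact ⟨h1, h2, h4, fun _ => h3.ne⟩
  refine isPreconnected_of_forall ((-ε, 0), 1) ?_
  rintro ⟨⟨x, y⟩, ζ⟩ ⟨h1, h2, h3, h4⟩
  by_cases h0 : ζ = 0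
  · refine ⟨_, (key 1 h1c one_ne_zero).2, Or.inl (Or.inl ⟨m₁, h1c⟩), ?_,
      (key 1 h1c one_ne_zero).1⟩
    rcases lt_or_gt_of_ne (h4 h0) with h | h
    · exact Or.inr ⟨⟨⟨h1, h2⟩, h⟩, h3⟩
    · exact Or.inl (Or.inl ⟨⟨⟨h1, h2⟩, h⟩, h3⟩)
  · exact ⟨_, (key ζ h3 h0).2, Or.inl (Or.inl ⟨m₁, h1c⟩), Or.inl (Or.inr ⟨⟨h1, h2⟩, rfl⟩),
      (key ζ h3 h0).1⟩

theorem normalForm_mem (hC : IsSign C ε) {p : (ℝ × ℝ) × ℂ} (hp : p ∈ params ε) :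
    normalForm hC p ∈ squares C := by
  obtain ⟨⟨x, y⟩, ζ⟩ := p
  obtain ⟨h1, h2, h3, h4⟩ := hp
  simp only at h1 h2 h3 h4
  obtain ⟨c1, c2, c3, c4⟩ := hC.apply
  have hε := hC.mul_self_coe
  have he : Complex.exp ζ * Complex.exp (-ζ) = 1 := by
    rw [← Complex.exp_add, add_neg_cancel, Complex.exp_zero]
  refine ⟨?_, ?_, ?_⟩
  · apply SL_ext <;> simp only [normalForm, Matrix.cons_val, c1, c2, c3, c4, mul_00, mul_01,
      mul_10, mul_11, mk2_00, mk2_01, mk2_10, mk2_11, companion]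
    · linear_combination ε * he
    · linear_combination (y * Complex.exp (-ζ)) * hε
    · ring
    · linear_combination ε * he
  · intro i
    fin_cases i
    · simp [GoodTrace, tr, normalForm, companion, mk2_00, mk2_11, h1]
    · simp [GoodTrace, tr, normalForm, mk2_00, mk2_11, h2]
    · exact exp_add_exp_neg h3
  · intro h
    have e1 := congrArg (fun M : SL(2, ℂ) => M.1 0 0) h
    have e2 := congrArg (fun M : SL(2, ℂ) => M.1 0 1) h
    simp only [normalForm, Matrix.cons_val, mul_00, mul_01, mk2_00, mk2_01, mk2_10, mk2_11,
      companion] at e1 e2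
    -- Commutation gives `exp (2ζ) = 1`. The value `exp ζ = -1` violates the trace bound, and `ζ =
    -- 0` leads to the excluded line.
    have e3 : (Complex.exp ζ - 1) * (Complex.exp ζ + 1) = 0 := by
      linear_combination (-ε * Complex.exp ζ) * e1 + (1 - Complex.exp ζ ^ 2) * hε + (ε * ε) * he
    rcases mul_eq_zero.1 e3 with e3 | e3
    · have e4 : Complex.exp ζ = 1 := by linear_combination e3
      have him : |ζ.im| < Real.pi := by
        rcases h3 with h3 | h3
        · rw [h3, abs_zero]; exact Real.pi_pos
        · exact h3.2
      have h0 : ζ = 0 := by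
        rw [← Complex.log_exp (abs_lt.1 him).1 (abs_lt.1 him).2.le, e4, Complex.log_one]
      refine h4 h0 ?_
      rw [e4] at e2
      have : (y : ℂ) = ((ε * x : ℝ) : ℂ) := by push_cast; linear_combination -e2
      exact_mod_cast this
    · have e4 : Complex.exp ζ = -1 := by linear_combination e3
      have e5 : Complex.exp (-ζ) = -1 := by rw [Complex.exp_neg, e4]; norm_num
      have := (exp_add_exp_neg h3).2
      rw [e4, e5] at this
      norm_num at this

end normalForm

/-! ### Common eigenvectors and connectedness of the space of squares -/

/-- The roots of each form are substituted into the other. The difference of the two resulting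
relations carries the square root of the discriminant as a factor, so the case of two double roots
is treated apart. -/
theorem proportional_of_zeros {a b c a' b' c' : ℂ}
    (h : ∀ u v : ℂ, a * u ^ 2 + b * u * v + c * v ^ 2 = 0 ↔
      a' * u ^ 2 + b' * u * v + c' * v ^ 2 = 0) :
    a * b' = a' * b ∧ a * c' = a' * c ∧ b * c' = b' * c := by
  have ha : a = 0 ↔ a' = 0 := by simpa using h 1 0
  by_cases h0 : a = 0
  · have h0' := ha.1 h0
    have k1 : b * (c' * b - b' * c) = 0 := by
      have := (h c (-b)).1 (by rw [h0]; ring)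
      rw [h0'] at this
      linear_combination this
    have k2 : b' * (c * b' - b * c') = 0 := by
      have := (h c' (-b')).2 (by rw [h0']; ring)
      rw [h0] at this
      linear_combination this
    refine ⟨by rw [h0, h0']; ring, by rw [h0, h0']; ring, ?_⟩
    rcases mul_eq_zero.1 k1 with k | k
    · rcases mul_eq_zero.1 k2 with k' | k'
      · rw [k, k']; ring
      · linear_combination -k'
    · linear_combination k
  · have h0' : a' ≠ 0 := fun e => h0 (ha.2 e)
    obtain ⟨d, hd⟩ := IsAlgClosed.exists_pow_nat_eq (b ^ 2 - 4 * a * c) two_pos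
    obtain ⟨d', hd'⟩ := IsAlgClosed.exists_pow_nat_eq (b' ^ 2 - 4 * a' * c') two_pos
    have k1 := (h (-b + d) (2 * a)).1 (by linear_combination a * hd)
    have k2 := (h (-b - d) (2 * a)).1 (by linear_combination a * hd)
    have k3 := (h (-b' + d') (2 * a')).2 (by linear_combination a' * hd')
    have k4 := (h (-b' - d') (2 * a')).2 (by linear_combination a' * hd')
    have m1 : d * (a * b' - a' * b) = 0 := by linear_combination (k1 - k2) / 4
    have m2 : d' * (a * b' - a' * b) = 0 := by linear_combination -(k3 - k4) / 4
    have m3 : a' * b ^ 2 - 2 * a' * a * c - a * b * b' + 2 * a ^ 2 * c' = 0 := by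
      linear_combination (k1 + k2) / 4 - a' * hd / 2
    have m4 : a * b' - a' * b = 0 := by
      by_contra hne
      rcases mul_eq_zero.1 m1 with m1 | m1
      · rcases mul_eq_zero.1 m2 with m2 | m2
        · rw [m1] at hd
          rw [m2] at hd'
          have : (a * b' - a' * b) ^ 2 = 0 := by
            linear_combination 2 * a' * m3 + a' ^ 2 * hd - a ^ 2 * hd'
          exact hne (pow_eq_zero_iff two_ne_zero |>.1 this)
        · exact hne m2
      · exact hne m1
    have m5 : a * c' = a' * c := by
      have : a * (a * c' - a' * c) = 0 := by linear_combination m3 / 2 + b * m4 / 2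
      linear_combination (mul_eq_zero.1 this).resolve_left h0
    refine ⟨by linear_combination m4, m5, ?_⟩
    have : a * (b * c' - b' * c) = 0 := by linear_combination b * m5 - c * m4
    linear_combination (mul_eq_zero.1 this).resolve_left h0

/-- The coefficients of `eigenForm A` are those of the traceless part of `A`, so proportional forms
mean proportional traceless parts. -/
theorem commute_of_eigenForm {A B : SL(2, ℂ)}
    (h : ∀ u v, eigenForm A u v = 0 ↔ eigenForm B u v = 0) : A * B = B * A := by
  obtain ⟨h1, h2, h3⟩ := proportional_of_zeros (a := A.1 1 0) (b := A.1 1 1 - A.1 0 0)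
    (c := -A.1 0 1) (a' := B.1 1 0) (b' := B.1 1 1 - B.1 0 0) (c' := -B.1 0 1) (by
      intro u v
      have := h u v
      simp only [eigenForm] at this
      convert this using 2 <;> ring)
  apply SL_ext <;> simp only [mul_00, mul_01, mul_10, mul_11]
  · linear_combination h2
  · linear_combination h3
  · linear_combination -h1
  · linear_combination -h2

/-- The triples conjugate to a normal form. -/
def normalTriples {C : SL(2, ℂ)} {ε : ℝ} (hC : IsSign C ε) : Set (Fin 3 → SL(2, ℂ)) :=
  (fun q : SL(2, ℂ) × ((ℝ × ℝ) × ℂ) => fun i => q.1 * normalForm hC q.2 i * q.1⁻¹) ''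
    (Set.univ ×ˢ params ε)

theorem isPreconnected_normalTriples {C : SL(2, ℂ)} {ε : ℝ} (hC : IsSign C ε) :
    IsPreconnected (normalTriples hC) := by
  refine (isPreconnected_SL.prod (isPreconnected_params hC)).image _ (Continuous.continuousOn ?_)
  refine continuous_pi fun i => (continuous_fst.mul ?_).mul continuous_fst.inv
  exact (continuous_apply i).comp ((continuous_normalForm hC).comp continuous_snd)

theorem normalTriples_subset {C : SL(2, ℂ)} {ε : ℝ} (hC : IsSign C ε) :
    normalTriples hC ⊆ squares C := by
  rintro _ ⟨⟨g, p⟩, ⟨-, hp⟩, rfl⟩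
  exact conj_mem_squares hC (normalForm_mem hC hp) g

/-- In the basis with first vector proportional to `(u, v)`, `B 0` is a companion matrix and `B 2`
is upper triangular. The product relation then determines `B 1`, and the trace of `B 1` determines
the corner entry of `B 2`. -/
theorem mem_normalTriples {C : SL(2, ℂ)} {ε : ℝ} (hC : IsSign C ε) {B : Fin 3 → SL(2, ℂ)}
    (hB : B ∈ squares C) {u v : ℂ} (h2 : eigenForm (B 2) u v = 0) (h0 : eigenForm (B 0) u v ≠ 0) :
    B ∈ normalTriples hC := by
  obtain ⟨b1, b2, b3⟩ := hB
  obtain ⟨g, d, hd, rfl, rfl, hg⟩ := exists_companion_of_eigenForm h0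
  obtain ⟨c1, c2, c3, c4⟩ := hC.apply
  have hε := hC.mul_self_coe
  set x := (tr (B 0)).re with hx
  set y := (tr (B 1)).re with hy
  have hx' : tr (B 0) = x := Complex.ext rfl (by simpa using (b2 0).1)
  have hy' : tr (B 1) = y := Complex.ext rfl (by simpa using (b2 1).1)
  rw [hx'] at hg
  obtain ⟨K, hK⟩ : ∃ K, B 2 = g * K * g⁻¹ := ⟨g⁻¹ * B 2 * g, by group⟩
  have hK0 : K.1 1 0 = 0 := by
    have e : K = g⁻¹ * B 2 * g := by rw [hK]; group
    have e2 : d ^ 2 * K.1 1 0 = 0 := by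
      rw [← h2, e]
      simp only [mul_10, mul_11, inv_10, inv_11, eigenForm]
      ring
    exact (mul_eq_zero.1 e2).resolve_left (pow_ne_zero 2 hd)
  have hKd := det_SL K
  rw [hK0, mul_zero, sub_zero] at hKd
  have hσ : K.1 0 0 ≠ 0 := left_ne_zero_of_mul_eq_one hKd
  have hσ' : K.1 1 1 = (K.1 0 0)⁻¹ := eq_inv_of_mul_eq_one_right hKd
  have ht : tr (B 2) = K.1 0 0 + (K.1 0 0)⁻¹ := by rw [hK, tr_conj, tr, hσ']
  obtain ⟨ζ, hζ, hζσ⟩ := exists_cross hσ (by rw [← ht]; exact (b2 2).1)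
    (by rw [← ht]; exact (b2 2).2)
  have hζσ' : Complex.exp (-ζ) = K.1 1 1 := by rw [Complex.exp_neg, hζσ, hσ']
  have hB1 : B 1 = g * ((companion x)⁻¹ * C * K⁻¹) * g⁻¹ := by
    have e : B 1 = (B 0)⁻¹ * C * (B 2)⁻¹ := by rw [← b1]; group
    rw [e, hg, hK, mul_assoc _ C, ← hC.comm]
    simp only [mul_inv_rev, inv_inv, mul_assoc, inv_mul_cancel_left]
    rw [← mul_assoc K⁻¹ g⁻¹ C, hC.comm]
  have hβ : K.1 0 1 = ε * y - x * K.1 0 0 := by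
    have : (y : ℂ) = ε * (K.1 0 1 + x * K.1 0 0) := by
      rw [← hy', hB1, tr_conj, tr]
      simp only [mul_10, mul_11, mul_00, mul_01, inv_00, inv_01, inv_10, inv_11, companion,
        mk2_00, mk2_01, mk2_10, mk2_11, c1, c2, c3, c4, hK0]
      ring
    rw [this]
    linear_combination -(K.1 0 1 + x * K.1 0 0) * hε
  refine ⟨⟨g, ((x, y), ζ)⟩, ⟨trivial, (b2 0).2, (b2 1).2, hζ, ?_⟩, ?_⟩
  · rintro h0 h
    simp only at h0 h
    refine b3 ?_
    rw [h0, Complex.exp_zero] at hζσ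
    have hK1 : K = 1 := by
      apply SL_ext
      · rw [← hζσ]; rfl
      · rw [hβ, ← hζσ, h]
        push_cast
        change _ = (0 : ℂ)
        linear_combination (x : ℂ) * hε
      · rw [hK0]; rfl
      · rw [hσ', ← hζσ]; simp
    rw [hK1, mul_one, mul_inv_cancel] at hK
    rw [hK, mul_one] at b1
    have e : B 1 = (B 0)⁻¹ * C := by rw [← b1]; group
    rw [e, mul_assoc, ← hC.comm]
    simp
  · funext i
    fin_cases i
    · exact hg.symm
    · change g * (normalForm hC ((x, y), ζ) 1) * g⁻¹ = B 1
      rw [hB1]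
      congr 2
      apply SL_ext <;> simp only [normalForm, Matrix.cons_val, mul_10, mul_11, mul_00, mul_01,
        inv_00, inv_01, inv_10, inv_11, companion,
        mk2_00, mk2_01, mk2_10, mk2_11, c1, c2, c3, c4, hK0, hζσ, hζσ', hβ]
      · ring
      · ring
      · ring
      · linear_combination (-y) * hε
    · change g * (normalForm hC ((x, y), ζ) 2) * g⁻¹ = B 2
      rw [hK]
      congr 2
      apply SL_ext <;> simp only [normalForm, Matrix.cons_val, mk2_00, mk2_01, mk2_10, mk2_11,
        hK0, hζσ, hζσ', hβ]

/-- The normal triples and their two cyclic shifts cover: a triple outside all three would have the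
eigenvectors of `B 2` inside those of `B 0`, these inside those of `B 1`, and these inside those of
`B 2`, hence would commute. The three sets share the triple `N`. -/
theorem isConnected_squares {C : SL(2, ℂ)} {ε : ℝ} (hC : IsSign C ε) :
    IsConnected (squares C) := by
  have hε := hC.mul_self_coe
  set N := normalForm hC ((0, 2), 0) with hN
  have hp : (((0 : ℝ), (2 : ℝ)), (0 : ℂ)) ∈ params ε :=
    ⟨by norm_num, by norm_num, Or.inl rfl, fun _ => by norm_num⟩
  have hNs : N ∈ squares C := normalForm_mem hC hp
  have hN0 : N ∈ normalTriples hC := ⟨⟨1, _⟩, ⟨trivial, hp⟩, by funext i; simp [hN]⟩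
  have hε0 : (ε : ℂ) ≠ 0 := left_ne_zero_of_mul_eq_one hε
  have hN1 : shift N ∈ normalTriples hC := by
    -- `(1, -i)` is an eigenvector of the rotation `N 0 = companion 0` but not of `N 1`.
    refine mem_normalTriples hC (shift_mem_squares hC hNs) (u := 1) (v := -Complex.I) ?_ ?_
    · change eigenForm (N 0) _ _ = 0
      simp [hN, normalForm, eigenForm, companion, mk2_00, mk2_01, mk2_10, mk2_11]
    · change eigenForm (N 1) _ _ ≠ 0
      simp only [hN, normalForm, eigenForm, mk2_00, mk2_01, mk2_10, mk2_11, Matrix.cons_val]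
      intro h
      have h' : (2 : ℂ) * Complex.I = 0 := by
        simp only [neg_zero, Complex.exp_zero] at h
        push_cast at h
        linear_combination -h - ε * Complex.I_sq
      simp at h'
  have hN2 : shift (shift N) ∈ normalTriples hC := by
    refine mem_normalTriples hC (shift_mem_squares hC (shift_mem_squares hC hNs))
      (u := ε) (v := 1) ?_ ?_
    · change eigenForm (N 1) _ _ = 0
      simp only [hN, normalForm, eigenForm, mk2_00, mk2_01, mk2_10, mk2_11, Matrix.cons_val,
        neg_zero, Complex.exp_zero]
      push_cast
      linear_combination -ε * hε
    · change eigenForm (N 2) _ _ ≠ 0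
      simp only [hN, normalForm, eigenForm, mk2_00, mk2_01, mk2_10, mk2_11, Matrix.cons_val,
        neg_zero, Complex.exp_zero]
      intro h
      apply hε0
      push_cast at h
      linear_combination -h / 2
  have hcov : squares C = normalTriples hC ∪ shift '' normalTriples hC ∪
      (shift ∘ shift) '' normalTriples hC := by
    refine Set.Subset.antisymm ?_ ?_
    · intro B hB
      by_contra hne
      have hne0 : B ∉ normalTriples hC := fun h => hne (Or.inl (Or.inl h))
      have hne1 : shift (shift B) ∉ normalTriples hC := fun h =>
        hne (Or.inl (Or.inr ⟨_, h, shift_shift_shift B⟩))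
      have hne2 : shift B ∉ normalTriples hC := fun h =>
        hne (Or.inr ⟨_, h, shift_shift_shift B⟩)
      have i0 : ∀ u v, eigenForm (B 2) u v = 0 → eigenForm (B 0) u v = 0 := fun u v h => by
        by_contra h'
        exact hne0 (mem_normalTriples hC hB h h')
      have i1 : ∀ u v, eigenForm (B 1) u v = 0 → eigenForm (B 2) u v = 0 := fun u v h => by
        by_contra h'
        exact hne1 (mem_normalTriples hC (shift_mem_squares hC (shift_mem_squares hC hB)) h h')
      have i2 : ∀ u v, eigenForm (B 0) u v = 0 → eigenForm (B 1) u v = 0 := fun u v h => by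
        by_contra h'
        exact hne2 (mem_normalTriples hC (shift_mem_squares hC hB) h h')
      exact hB.2.2 (commute_of_eigenForm fun u v => ⟨i2 u v, fun h => i0 u v (i1 u v h)⟩)
    · rintro B ((h | ⟨B', h, rfl⟩) | ⟨B', h, rfl⟩)
      · exact normalTriples_subset hC h
      · exact shift_mem_squares hC (normalTriples_subset hC h)
      · exact shift_mem_squares hC (shift_mem_squares hC (normalTriples_subset hC h))
  refine ⟨⟨N, hNs⟩, ?_⟩
  have hpre := isPreconnected_normalTriples hC
  rw [hcov]
  refine IsPreconnected.union N (Or.inl hN0) ⟨_, hN1, shift_shift_shift N⟩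
    (IsPreconnected.union N hN0 ⟨_, hN2, shift_shift_shift N⟩ hpre ?_) ?_
  · exact hpre.image _ continuous_shift.continuousOn
  · exact hpre.image _ (continuous_shift.comp continuous_shift).continuousOn

/-! ### From squares to isometries: connectedness of `X'₃(±1)` -/

/-- Near an element of `G₋` with non-central square, the square map hits every element of real
trace. -/
theorem exists_near_Q_eq {g : G} (hg : g ∈ Gminus) (h1 : Q g ≠ 1) (h2 : Q g ≠ -1) {U : Set G}
    (hU : U ∈ 𝓝 g) :
    ∀ᶠ B in 𝓝 (Q g), (tr B).im = 0 → ∃ g' ∈ U, g' ∈ Gminus ∧ Q g' = B := by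
  obtain ⟨A, rfl⟩ := exists_refl hg
  rw [Q_refl] at *
  filter_upwards [exists_near_lift h1 h2 (continuous_refl.continuousAt.preimage_mem_nhds hU)]
    with B hB hB'
  obtain ⟨A', hA', rfl⟩ := hB hB'
  exact ⟨refl A', hA', refl_mem _, Q_refl _⟩

theorem exists_near_Q_eq_pi {A : Fin 3 → G} (hA : ∀ i, A i ∈ Gminus)
    (hc : ∀ i, Q (A i) ≠ 1 ∧ Q (A i) ≠ -1) {U : Set (Fin 3 → G)} (hU : U ∈ 𝓝 A) :
    ∀ᶠ B in 𝓝 (fun i => Q (A i)), (∀ i, (tr (B i)).im = 0) →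
      ∃ A' ∈ U, (∀ i, A' i ∈ Gminus) ∧ ∀ i, Q (A' i) = B i := by
  rw [nhds_pi, Filter.mem_pi] at hU
  obtain ⟨I, -, V, hV, hVU⟩ := hU
  have h := fun i => exists_near_Q_eq (hA i) (hc i).1 (hc i).2 (hV i)
  have h' : ∀ᶠ B : Fin 3 → SL(2, ℂ) in 𝓝 (fun i => Q (A i)), ∀ i, (tr (B i)).im = 0 →
      ∃ g' ∈ V i, g' ∈ Gminus ∧ Q g' = B i :=
    eventually_all.2 fun i =>
      ((continuous_apply i).tendsto (fun i => Q (A i))).eventually (h i)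
  filter_upwards [h'] with B hB hB'
  choose A' a1 a2 a3 using fun i => hB i (hB' i)
  exact ⟨A', hVU fun i _ => a1 i, a2, a3⟩

/-- The total space of a relatively open map with connected fibres and connected base. -/
theorem isPreconnected_of_fibres {α β : Type*} [TopologicalSpace α] [TopologicalSpace β]
    {f : α → β} {S : Set α} {T : Set β} (hT : IsPreconnected T) (hST : Set.MapsTo f S T)
    (hf : ∀ t ∈ T, IsConnected {a | a ∈ S ∧ f a = t})
    (ho : ∀ a ∈ S, ∀ U ∈ 𝓝 a, ∀ᶠ t in 𝓝 (f a), t ∈ T → ∃ a' ∈ U, a' ∈ S ∧ f a' = t) :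
    IsPreconnected S := by
  -- Images of open pieces of `S` are relatively open in `T`. If two pieces cover `S`, their images
  -- meet in some `t`, and the connected fibre over `t` meets both pieces at a common point.
  have key : ∀ U : Set α, IsOpen U → ∃ V : Set β, IsOpen V ∧
      ∀ t ∈ T, t ∈ V ↔ ∃ a ∈ U, a ∈ S ∧ f a = t := by
    intro U hU
    refine ⟨interior {t | t ∈ T → ∃ a ∈ U, a ∈ S ∧ f a = t}, isOpen_interior, fun t ht => ?_⟩
    refine ⟨fun h => interior_subset h ht, ?_⟩
    rintro ⟨a, ha, haS, rfl⟩
    exact mem_interior_iff_mem_nhds.2 (ho a haS U (hU.mem_nhds ha))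
  rintro U U' hU hU' hcov ⟨a, haS, haU⟩ ⟨a', haS', haU'⟩
  obtain ⟨V, hV, hVm⟩ := key U hU
  obtain ⟨V', hV', hVm'⟩ := key U' hU'
  obtain ⟨t, htT, htV, htV'⟩ := hT V V' hV hV' (fun t ht => by
      obtain ⟨b, hbS, rfl⟩ := (hf t ht).nonempty
      rcases hcov hbS with hb | hb
      · exact Or.inl ((hVm _ ht).2 ⟨b, hb, hbS, rfl⟩)
      · exact Or.inr ((hVm' _ ht).2 ⟨b, hb, hbS, rfl⟩))
    ⟨f a, hST haS, (hVm _ (hST haS)).2 ⟨a, haU, haS, rfl⟩⟩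
    ⟨f a', hST haS', (hVm' _ (hST haS')).2 ⟨a', haU', haS', rfl⟩⟩
  obtain ⟨b, hb, hbS, hbt⟩ := (hVm t htT).1 htV
  obtain ⟨b', hb', hbS', hbt'⟩ := (hVm' t htT).1 htV'
  obtain ⟨c, ⟨hcS, -⟩, hc⟩ := (hf t htT).isPreconnected U U' hU hU' (fun x hx => hcov hx.1)
    ⟨b, ⟨hbS, hbt⟩, hb⟩ ⟨b', ⟨hbS', hbt'⟩, hb'⟩
  exact ⟨c, hcS, hc⟩

section triples

variable {C : SL(2, ℂ)} {ε : ℝ}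

theorem noncentral_of_not_commute (hC : IsSign C ε) {B : Fin 3 → SL(2, ℂ)}
    (h : B 0 * B 1 * B 2 = C) (hn : B 0 * B 1 ≠ B 1 * B 0) (i : Fin 3) :
    B i ≠ 1 ∧ B i ≠ -1 := by
  have hneg : ∀ A : SL(2, ℂ), A * -1 = -1 * A := fun A => by ext i j; simp
  have e : B 0 * B 1 = C * (B 2)⁻¹ := by rw [← h]; group
  have e' : B 1 = (B 0)⁻¹ * (C * (B 2)⁻¹) := by rw [← e]; group
  have key : ∀ Z : SL(2, ℂ), (∀ A, A * Z = Z * A) → B i ≠ Z := by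
    intro Z hZ hi
    apply hn
    fin_cases i
    · change B 0 = Z at hi
      rw [hi, hZ]
    · change B 1 = Z at hi
      rw [hi, hZ]
    · change B 2 = Z at hi
      have hZi : ∀ A : SL(2, ℂ), A * Z⁻¹ = Z⁻¹ * A := fun A => by
        rw [mul_inv_eq_iff_eq_mul, mul_assoc, hZ, inv_mul_cancel_left]
      have hC' : Commute (B 0) C := hC.comm _
      have hZ' : Commute (B 0) Z⁻¹ := hZi _
      rw [e', hi]
      exact (Commute.refl (B 0)).inv_right.mul_right (hC'.mul_right hZ')
  exact ⟨key 1 fun A => by rw [mul_one, one_mul], key (-1) hneg⟩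

theorem mem_X_iff {A : Fin 3 → G} :
    A ∈ X 3 C ↔ (∀ i, A i ∈ Gminus) ∧ Q (A 0) * Q (A 1) * Q (A 2) = C := by
  rw [← liftedRelator_three]; rfl

theorem mem_X'_of_not_commute {A : Fin 3 → G} (hA : A ∈ X 3 C)
    (h : Q (A 0) * Q (A 1) ≠ Q (A 1) * Q (A 0)) : A ∈ X' 3 C :=
  ⟨hA, 0, 1, fun h' => h (commutatorElement_eq_one_iff_mul_comm.1 h')⟩

theorem not_commute_of_mem_X' (hC : IsSign C ε) {A : Fin 3 → G} (hA : A ∈ X' 3 C) :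
    Q (A 0) * Q (A 1) ≠ Q (A 1) * Q (A 0) := by
  obtain ⟨hX, i, j, hij⟩ := hA
  rw [mem_X_iff] at hX
  intro h
  apply hij
  rw [commutatorElement_eq_one_iff_mul_comm]
  have e : Q (A 2) = (Q (A 1))⁻¹ * (Q (A 0))⁻¹ * C := by rw [← hX.2]; group
  have h01 : Commute (Q (A 0)) (Q (A 1)) := h
  have hc : ∀ Z, Commute Z C := fun Z => hC.comm Z
  have h02 : Commute (Q (A 0)) (Q (A 2)) := by
    rw [e]; exact (h01.inv_right.mul_right (Commute.refl _).inv_right).mul_right (hc _)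
  have h12 : Commute (Q (A 1)) (Q (A 2)) := by
    rw [e]; exact ((Commute.refl _).inv_right.mul_right h01.symm.inv_right).mul_right (hc _)
  fin_cases i <;> fin_cases j
  · rfl
  · exact h01
  · exact h02
  · exact h01.symm
  · rfl
  · exact h12
  · exact h02.symm
  · exact h12.symm
  · rfl

/-- With central product, any failure of commutation is one between the first two squares. It makes
all squares non-central, so their traces are automatically good. -/
theorem mem_X'_iff (hC : IsSign C ε) {A : Fin 3 → G} :
    A ∈ X' 3 C ↔ (∀ i, A i ∈ Gminus) ∧ (fun i => Q (A i)) ∈ squares C := by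
  constructor
  · intro h
    have hn := not_commute_of_mem_X' hC h
    have hX := mem_X_iff.1 h.1
    refine ⟨hX.1, hX.2, fun i => ?_, hn⟩
    have hi := noncentral_of_not_commute hC (B := fun i => Q (A i)) hX.2 hn i
    obtain ⟨P, hP⟩ := exists_refl (hX.1 i)
    simp only [hP, Q_refl] at hi ⊢
    exact goodTrace_of_noncentral hi.1 hi.2
  · rintro ⟨h1, h2, -, h3⟩
    exact mem_X'_of_not_commute (mem_X_iff.2 ⟨h1, h2⟩) h3

/-- The fibre over a triple of squares is a product of three connected fibres of `Q`. -/
theorem isConnected_X' (hC : IsSign C ε) : IsConnected (X' 3 C) := by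
  have hfib : ∀ B ∈ squares C, IsConnected {A : Fin 3 → G | A ∈ X' 3 C ∧ (fun i => Q (A i)) = B} := by
    intro B hB
    have : {A : Fin 3 → G | A ∈ X' 3 C ∧ (fun i => Q (A i)) = B} =
        Set.univ.pi fun i => {g | g ∈ Gminus ∧ Q g = B i} := by
      ext A
      rw [Set.mem_ofPred_eq, mem_X'_iff hC]
      constructor
      · rintro ⟨⟨h1, -⟩, rfl⟩ i -
        exact ⟨h1 i, rfl⟩
      · intro h
        have e : (fun i => Q (A i)) = B := funext fun i => (h i trivial).2
        exact ⟨⟨fun i => (h i trivial).1, by rwa [e]⟩, e⟩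
    rw [this]
    refine isConnected_univ_pi.2 fun i => ?_
    have hi := noncentral_of_not_commute hC hB.1 hB.2.2 i
    exact isConnected_fibre hi.1 hi.2 (hB.2.1 i)
  have hconn := isConnected_squares hC
  constructor
  · obtain ⟨B, hB⟩ := hconn.nonempty
    obtain ⟨A, hA, -⟩ := (hfib B hB).nonempty
    exact ⟨A, hA⟩
  · refine isPreconnected_of_fibres (f := fun (A : Fin 3 → G) i => Q (A i)) hconn.isPreconnected
      (fun A hA => ((mem_X'_iff hC).1 hA).2) hfib ?_
    intro A hA U hU
    have hA' := (mem_X'_iff hC).1 hA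
    filter_upwards [exists_near_Q_eq_pi hA'.1
      (fun i => noncentral_of_not_commute hC (B := fun i => Q (A i)) hA'.2.1 hA'.2.2.2 i) hU]
      with B hB hBs
    obtain ⟨A', a1, a2, a3⟩ := hB fun i => (hBs.2.1 i).1
    have e : (fun i => Q (A' i)) = B := funext a3
    exact ⟨A', a1, (mem_X'_iff hC).2 ⟨a2, by rwa [e]⟩, e⟩

theorem shift_mem_X' (hC : IsSign C ε) {A : Fin 3 → G} (hA : A ∈ X' 3 C) : shift A ∈ X' 3 C := by
  obtain ⟨h1, h2⟩ := (mem_X'_iff hC).1 hA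
  have e : (fun i => Q (shift A i)) = shift (fun i => Q (A i)) := rfl
  refine (mem_X'_iff hC).2 ⟨fun i => h1 _, ?_⟩
  rw [e]
  exact shift_mem_squares hC h2

theorem shift_mem_X (hC : IsSign C ε) {A : Fin 3 → G} (hA : A ∈ X 3 C) : shift A ∈ X 3 C := by
  obtain ⟨h1, h2⟩ := mem_X_iff.1 hA
  refine mem_X_iff.2 ⟨fun i => h1 _, ?_⟩
  change Q (A 1) * Q (A 2) * Q (A 0) = C
  have : Q (A 1) * Q (A 2) = (Q (A 0))⁻¹ * C := by rw [← h2]; group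
  rw [this, mul_assoc, ← hC.comm, inv_mul_cancel_left]

theorem shift_mem_closure (hC : IsSign C ε) {A : Fin 3 → G} (hA : A ∈ closure (X' 3 C)) :
    shift A ∈ closure (X' 3 C) :=
  map_mem_closure continuous_shift hA fun _ h => shift_mem_X' hC h

end triples

/-! ### Density at commuting triples with non-central squares -/

theorem mem_closure_of_path {α : Type*} [TopologicalSpace α] {S : Set α} {p : ℝ → α}
    (hp : ContinuousAt p 0) (h : ∀ᶠ t in 𝓝[≠] 0, p t ∈ S) : p 0 ∈ closure S :=
  mem_closure_of_tendsto (hp.tendsto.mono_left nhdsWithin_le_nhds) h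

section squares

variable {C : SL(2, ℂ)} {ε : ℝ}

theorem tr_inv_mul_sign (hC : IsSign C ε) (M : SL(2, ℂ)) : tr (M⁻¹ * C) = ε * tr M := by
  obtain ⟨c1, c2, c3, c4⟩ := hC.apply
  simp only [tr, mul_00, mul_11, inv_00, inv_01, inv_10, inv_11, c1, c2, c3, c4]
  ring

/-- The third matrix is recovered as `(K L)⁻¹ C`. Its trace is `ε tr (K L)`, so keeping `tr (K L)`
constant keeps the path in `squares`. -/
theorem mem_closure_squares_of_path (hC : IsSign C ε) {B : Fin 3 → SL(2, ℂ)}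
    (hB : B 0 * B 1 * B 2 = C) (hB2 : GoodTrace (B 2)) {g : SL(2, ℂ)} {K L : ℝ → SL(2, ℂ)}
    (hKc : Continuous K) (hLc : Continuous L) (hK0 : B 0 = g * K 0 * g⁻¹)
    (hL0 : B 1 = g * L 0 * g⁻¹) (hK : ∀ t, GoodTrace (K t)) (hL : ∀ t, GoodTrace (L t))
    (hKL : ∀ t, tr (K t * L t) = tr (K 0 * L 0)) (hn : ∀ t ≠ 0, K t * L t ≠ L t * K t) :
    B ∈ closure (squares C) := by
  let p : ℝ → Fin 3 → SL(2, ℂ) := fun t i => g * (![K t, L t, (K t * L t)⁻¹ * C] i) * g⁻¹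
  have e2 : B 2 = g * ((K 0 * L 0)⁻¹ * C) * g⁻¹ := by
    have : B 2 = (B 0 * B 1)⁻¹ * C := by rw [← hB]; group
    rw [this, hK0, hL0]
    have h := hC.comm g⁻¹
    simp only [mul_inv_rev, inv_inv, mul_assoc, inv_mul_cancel_left]
    rw [← h]
  have hp0 : p 0 = B := by
    funext i
    fin_cases i
    · exact hK0.symm
    · exact hL0.symm
    · exact e2.symm
  have hpc : Continuous p := by
    refine continuous_pi fun i => (continuous_const.mul ?_).mul continuous_const
    fin_cases i
    · exact hKc
    · exact hLc
    · exact (hKc.mul hLc).inv.mul continuous_const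
  rw [← hp0]
  refine mem_closure_of_path hpc.continuousAt ?_
  filter_upwards [self_mem_nhdsWithin] with t ht
  refine conj_mem_squares hC (B := ![K t, L t, (K t * L t)⁻¹ * C]) ⟨?_, ?_, hn t ht⟩ g
  · simp only [Matrix.cons_val]
    rw [mul_inv_cancel_left]
  · intro i
    fin_cases i
    · exact hK t
    · exact hL t
    · change GoodTrace ((K t * L t)⁻¹ * C)
      rw [GoodTrace, tr_inv_mul_sign hC, hKL, ← tr_inv_mul_sign hC, ← tr_conj g, ← e2]
      exact hB2

theorem exists_upper_triangular {B : SL(2, ℂ)} (h1 : B ≠ 1) (h2 : B ≠ -1) :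
    ∃ (g K : SL(2, ℂ)), B = g * K * g⁻¹ ∧ K.1 0 1 = -1 ∧ K.1 1 0 = 0 := by
  obtain ⟨g, hg⟩ := exists_companion h1 h2
  generalize tr B = x at hg
  obtain ⟨d, hd⟩ := IsAlgClosed.exists_pow_nat_eq (x ^ 2 - 4) two_pos
  -- The first column `((x + d) / 2, 1)` of this change of basis is an eigenvector of `companion x`.
  refine ⟨g * companion ((x + d) / 2),
    (companion ((x + d) / 2))⁻¹ * companion x * companion ((x + d) / 2), ?_, ?_, ?_⟩
  · rw [hg]
    group
  · simp only [companion, mul_00, mul_01, inv_00, inv_01, mk2_00, mk2_01, mk2_10, mk2_11]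
    ring
  · simp only [companion, mul_10, mul_11, inv_10, inv_11, mk2_00, mk2_01, mk2_10, mk2_11]
    linear_combination hd / 4

/-- Both matrices become upper triangular. If `K` has distinct eigenvalues, moving the corner of `L`
destroys commutation without changing any trace. Otherwise both are unipotent, and their diagonals
are deformed to `exp (± t)` inversely, so that the product stays unipotent. -/
theorem mem_closure_squares (hC : IsSign C ε) {B : Fin 3 → SL(2, ℂ)}
    (hB : B 0 * B 1 * B 2 = C) (hg : ∀ i, GoodTrace (B i)) (hn : ∀ i, B i ≠ 1 ∧ B i ≠ -1)
    (hcomm : B 0 * B 1 = B 1 * B 0) : B ∈ closure (squares C) := by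
  obtain ⟨g, K, hK, hK01, hK10⟩ := exists_upper_triangular (hn 0).1 (hn 0).2
  obtain ⟨L, hL⟩ : ∃ L, B 1 = g * L * g⁻¹ := ⟨g⁻¹ * B 1 * g, by group⟩
  have hKL : K * L = L * K := by
    rw [hK, hL] at hcomm
    have : g * (K * L) * g⁻¹ = g * (L * K) * g⁻¹ := by
      calc _ = g * K * g⁻¹ * (g * L * g⁻¹) := by group
        _ = _ := hcomm
        _ = _ := by group
    simpa using this
  have gK : GoodTrace K := by have := hg 0; rwa [hK, GoodTrace, tr_conj] at this
  have gL : GoodTrace L := by have := hg 1; rwa [hL, GoodTrace, tr_conj] at this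
  have k1 := congrArg (fun M : SL(2, ℂ) => M.1 0 0) hKL
  have k2 := congrArg (fun M : SL(2, ℂ) => M.1 0 1) hKL
  simp only [mul_00, mul_01, hK01, hK10] at k1 k2
  have hL10 : L.1 1 0 = 0 := by linear_combination -k1
  have dK := det_SL K
  have dL := det_SL L
  rw [hK10, mul_zero, sub_zero] at dK
  rw [hL10, mul_zero, sub_zero] at dL
  by_cases hσ : K.1 0 0 = K.1 1 1
  · have hμ : L.1 0 0 = L.1 1 1 := by rw [hσ] at k2; linear_combination k2
    have one_of : ∀ M : SL(2, ℂ), M.1 0 0 = M.1 1 1 → M.1 0 0 * M.1 1 1 = 1 → GoodTrace M →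
        M.1 1 1 = 1 := by
      intro M h h' hM
      rw [h] at h'
      have : (M.1 1 1 - 1) * (M.1 1 1 + 1) = 0 := by linear_combination h'
      rcases mul_eq_zero.1 this with h'' | h''
      · linear_combination h''
      · exfalso
        have e : M.1 1 1 = -1 := by linear_combination h''
        have := hM.2
        rw [tr, h, e] at this
        norm_num at this
    have hK1 := one_of K hσ dK gK
    have hL1 := one_of L hμ dL gL
    rw [hK1] at hσ
    rw [hL1] at hμ
    -- The corner of `K` is `-1`, so a corner `1` would give `K L = 1` and a central third square.
    have hβ : L.1 0 1 ≠ 1 := by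
      intro hβ
      have e1 : K * L = 1 := by
        apply SL_ext <;> simp [mul_00, mul_01, mul_10, mul_11, hσ, hμ, hK1, hL1, hK01, hK10, hL10,
          hβ]
      have e2 : B 0 * B 1 = 1 := by
        rw [hK, hL]
        calc _ = g * (K * L) * g⁻¹ := by group
          _ = 1 := by rw [e1, mul_one, mul_inv_cancel]
      rw [e2, one_mul] at hB
      rcases hC with ⟨h, -⟩ | ⟨h, -⟩
      · exact (hn 2).1 (hB.trans h)
      · exact (hn 2).2 (hB.trans h)
    have hexp : ∀ t : ℝ, Complex.exp t * Complex.exp (-t) = 1 := fun t => by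
      rw [← Complex.exp_add, add_neg_cancel, Complex.exp_zero]
    have hcross : ∀ t : ℝ, (t : ℂ) ∈ cross := fun t => Or.inl (Complex.ofReal_im t)
    refine mem_closure_squares_of_path hC hB (hg 2) (g := g)
      (K := fun t => mk2 (Complex.exp t) (-1) 0 (Complex.exp (-t)) (by simp [hexp]))
      (L := fun t => mk2 (Complex.exp (-t)) (L.1 0 1) 0 (Complex.exp t)
        (by rw [mul_comm]; simp [hexp])) ?_ ?_ ?_ ?_ ?_ ?_ ?_ ?_
    · exact continuous_mk2 _ (by fun_prop) (by fun_prop) (by fun_prop) (by fun_prop)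
    · exact continuous_mk2 _ (by fun_prop) (by fun_prop) (by fun_prop) (by fun_prop)
    · rw [hK]; congr 2
      apply SL_ext <;> simp [mk2_00, mk2_01, mk2_10, mk2_11, hσ, hK1, hK01, hK10]
    · rw [hL]; congr 2
      apply SL_ext <;> simp [mk2_00, mk2_01, mk2_10, mk2_11, hμ, hL1, hL10]
    · exact fun t => exp_add_exp_neg (hcross t)
    · intro t
      have := exp_add_exp_neg (hcross t)
      rwa [add_comm] at this
    · intro t
      simp only [tr, mul_00, mul_11, mk2_00, mk2_01, mk2_10, mk2_11, Complex.ofReal_zero, neg_zero,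
        Complex.exp_zero]
      linear_combination 2 * hexp t
    · intro t ht h
      have h' := congrArg (fun M : SL(2, ℂ) => M.1 0 1) h
      simp only [mul_01, mk2_00, mk2_01, mk2_11] at h'
      have h2 : (L.1 0 1 - 1) * (Complex.exp t - Complex.exp (-t)) = 0 := by linear_combination h'
      rcases mul_eq_zero.1 h2 with h2 | h2
      · exact hβ (by linear_combination h2)
      · have h3 : Real.exp t = Real.exp (-t) := by
          have : Complex.exp t = Complex.exp (-t) := by linear_combination h2
          exact_mod_cast this
        have := Real.exp_injective h3
        exact ht (by linarith)
  · refine mem_closure_squares_of_path hC hB (hg 2) (g := g) (K := fun _ => K)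
      (L := fun t => mk2 (L.1 0 0) (L.1 0 1 + t) 0 (L.1 1 1) (by simp [dL]))
      continuous_const ?_ hK ?_ (fun _ => gK) (fun t => gL) ?_ ?_
    · exact continuous_mk2 _ (by fun_prop) (by fun_prop) (by fun_prop) (by fun_prop)
    · rw [hL]; congr 2
      apply SL_ext <;> simp [mk2_00, mk2_01, mk2_10, mk2_11, hL10]
    · intro t
      simp only [tr, mul_00, mul_11, mk2_00, mk2_01, mk2_10, mk2_11, hK10]
      ring
    · intro t ht h
      have h' := congrArg (fun M : SL(2, ℂ) => M.1 0 1) h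
      simp only [mul_01, mk2_00, mk2_01, mk2_11, hK01] at h'
      have h2 : (t : ℂ) * (K.1 0 0 - K.1 1 1) = 0 := by linear_combination h' - k2
      rcases mul_eq_zero.1 h2 with h2 | h2
      · exact ht (by exact_mod_cast h2)
      · exact hσ (by linear_combination h2)

/-- Commuting triples with non-central squares are limits of non-commuting ones. -/
theorem mem_closure_of_noncentral (hC : IsSign C ε) {A : Fin 3 → G} (hA : A ∈ X 3 C)
    (hn : ∀ i, Q (A i) ≠ 1 ∧ Q (A i) ≠ -1) : A ∈ closure (X' 3 C) := by
  by_cases hcomm : Q (A 0) * Q (A 1) = Q (A 1) * Q (A 0)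
  · have hX := mem_X_iff.1 hA
    have hgood : ∀ i, GoodTrace (Q (A i)) := fun i => by
      obtain ⟨P, hP⟩ := exists_refl (hX.1 i)
      have hi := hn i
      simp only [hP, Q_refl] at hi ⊢
      exact goodTrace_of_noncentral hi.1 hi.2
    have hcl := mem_closure_squares hC (B := fun i => Q (A i)) hX.2 hgood hn hcomm
    rw [mem_closure_iff_nhds] at hcl ⊢
    intro U hU
    obtain ⟨B, hB, hBs⟩ := hcl _ (exists_near_Q_eq_pi hX.1 hn hU)
    obtain ⟨A', a1, a2, a3⟩ := hB fun i => (hBs.2.1 i).1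
    have e : (fun i => Q (A' i)) = B := funext a3
    exact ⟨A', a1, (mem_X'_iff hC).2 ⟨a2, by rwa [e]⟩⟩
  · exact subset_closure (mem_X'_of_not_commute hA hcomm)

end squares

/-! ### Bending an orientation-reversing isometry with central square -/

/-- Complex `2 × 2` matrices. -/
abbrev M2 : Type := Matrix (Fin 2) (Fin 2) ℂ

/-- The Lie algebra of the centralizer of `[P] c` when `P P̄` is central. -/
structure IsFixed (P : SL(2, ℂ)) (ξ : M2) : Prop where
  trace_eq : ξ.trace = 0
  comm : P.1 * cj ξ = ξ * P.1

theorem mul_self_of_trace {ξ : M2} (h : ξ.trace = 0) : ξ * ξ = (-ξ.det) • (1 : M2) := by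
  rw [Matrix.trace_fin_two] at h
  have h' : ξ 1 1 = -ξ 0 0 := by linear_combination h
  rw [Matrix.det_fin_two]
  ext i j
  fin_cases i <;> fin_cases j <;> simp [Matrix.mul_apply, h'] <;> ring

namespace IsFixed

variable {P : SL(2, ℂ)} {ξ : M2}

theorem neg (h : IsFixed P ξ) : IsFixed P (-ξ) where
  trace_eq := by rw [Matrix.trace_neg, h.trace_eq, neg_zero]
  comm := by rw [map_neg, mul_neg, neg_mul, h.comm]

theorem det_real (h : IsFixed P ξ) : ξ.det.im = 0 := by
  have := congrArg Matrix.det h.comm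
  rw [Matrix.det_mul, Matrix.det_mul, P.2, mul_one, one_mul, ← RingHom.map_det] at this
  exact Complex.conj_eq_iff_im.1 this

end IsFixed

/-- Left multiplication of `P` by the normalization of `1 + t ξ`. -/
def bend (P : SL(2, ℂ)) (ξ : M2) (t : ℝ) : SL(2, ℂ) := normSL ((1 + (t : ℂ) • ξ) * P.1)

theorem bend_zero (P : SL(2, ℂ)) (ξ : M2) : bend P ξ 0 = P := by
  simp [bend, normSL_coe]

theorem continuous_bend_aux (P : SL(2, ℂ)) (ξ : M2) :
    Continuous fun t : ℝ => (1 + (t : ℂ) • ξ) * P.1 :=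
  (continuous_const.add (Complex.continuous_ofReal.smul continuous_const)).matrix_mul
    continuous_const

theorem continuousAt_bend (P : SL(2, ℂ)) (ξ : M2) : ContinuousAt (bend P ξ) 0 := by
  refine ContinuousAt.comp (continuousAt_normSL ?_) (continuous_bend_aux P ξ).continuousAt
  rw [Complex.ofReal_zero, zero_smul, add_zero, one_mul, P.2]
  exact Complex.one_mem_slitPlane

/-- Since `P ξ̄ = ξ P`, the square becomes `(1 + t ξ)² P P̄` up to normalization, and `ξ² = -det ξ`.
The normalizing factor contributes `|c|² > 0`, so no sign is lost. -/
theorem bend_mul_conj {P : SL(2, ℂ)} {ξ : M2} {δ : ℝ} (hP : IsSign (P * conjSL P) δ)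
    (hξ : IsFixed P ξ) :
    ∀ᶠ t in 𝓝 (0 : ℝ), ∃ κ : ℝ, 0 < κ ∧ (bend P ξ t * conjSL (bend P ξ t)).1 =
      ((κ * δ : ℝ) : ℂ) • ((1 - (t : ℂ) ^ 2 * ξ.det) • (1 : M2) + (2 * (t : ℂ)) • ξ) := by
  have hev : ∀ᶠ t : ℝ in 𝓝 0, ((1 + (t : ℂ) • ξ) * P.1).det ≠ 0 := by
    refine (continuous_bend_aux P ξ).matrix_det.continuousAt.eventually_ne ?_
    rw [Complex.ofReal_zero, zero_smul, add_zero, one_mul, P.2]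
    exact one_ne_zero
  filter_upwards [hev] with t ht
  have hD : P.1 * cj P.1 = (δ : ℂ) • (1 : M2) := hP.coe
  have hdet0 := ht
  rw [Matrix.det_mul, P.2, mul_one] at hdet0
  set c := ((1 + (t : ℂ) • ξ) * P.1).det ^ (-(1 / 2) : ℂ) with hc
  have hc0 : c ≠ 0 := by
    rw [hc, Ne, Complex.cpow_eq_zero_iff]
    exact fun h => ht h.1
  refine ⟨Complex.normSq c, Complex.normSq_pos.2 hc0, ?_⟩
  rw [Matrix.SpecialLinearGroup.coe_mul, conjSL_coe, bend, coe_normSL ht, ← hc, cj_smul,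
    smul_mul_smul_comm, Complex.mul_conj, map_mul, map_add, map_one, cj_smul, Complex.conj_ofReal]
  have e : (1 + (t : ℂ) • ξ) * P.1 * ((1 + (t : ℂ) • cj ξ) * cj P.1) =
      (1 + (t : ℂ) • ξ) * (1 + (t : ℂ) • ξ) * (P.1 * cj P.1) := by
    have : P.1 * (1 + (t : ℂ) • cj ξ) = (1 + (t : ℂ) • ξ) * P.1 := by
      rw [mul_add, add_mul, mul_smul_comm, smul_mul_assoc, hξ.comm, mul_one, one_mul]
    rw [mul_assoc, ← mul_assoc P.1, this]
    noncomm_ring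
  rw [e, hD, mul_smul_comm, mul_one, smul_smul]
  have e2 : (1 + (t : ℂ) • ξ) * (1 + (t : ℂ) • ξ) =
      (1 - (t : ℂ) ^ 2 * ξ.det) • (1 : M2) + (2 * (t : ℂ)) • ξ := by
    have := mul_self_of_trace hξ.trace_eq
    rw [mul_add, mul_one, add_mul, one_mul, smul_mul_smul_comm, this, smul_smul, sub_smul, one_smul,
      two_mul, add_smul]
    rw [mul_neg, neg_smul, ← pow_two]
    abel
  rw [e2]
  push_cast
  rfl

section existence

variable {P : SL(2, ℂ)} {δ : ℝ}

/-- Conjugation by the antilinear map `v ↦ P v̄`. -/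
def twist (P : SL(2, ℂ)) (Y : M2) : M2 := P.1 * cj Y * (P⁻¹).1

theorem twist_mul (P : SL(2, ℂ)) (Y : M2) : twist P Y * P.1 = P.1 * cj Y := by
  have : (P⁻¹).1 * P.1 = 1 := by
    rw [← Matrix.SpecialLinearGroup.coe_mul, inv_mul_cancel, Matrix.SpecialLinearGroup.coe_one]
  rw [twist, mul_assoc, this, mul_one]

theorem inv_conjSL (hP : IsSign (P * conjSL P) δ) : (conjSL P)⁻¹ = P * conjSL P * P := by
  have h : (conjSL P)⁻¹ = (P * conjSL P)⁻¹ * P := by group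
  rwa [hP.inv] at h

theorem mul_cj_twist (hP : IsSign (P * conjSL P) δ) (Y : M2) :
    P.1 * cj (twist P Y) = Y * P.1 := by
  have h1 : P.1 * (conjSL P).1 = (P * conjSL P).1 := rfl
  have h2 : cj (P⁻¹).1 = ((P * conjSL P) * P).1 := by
    rw [← inv_conjSL hP, ← map_inv, conjSL_coe]
  have h3 : (P * conjSL P).1 * Y * (P * conjSL P).1 = Y := by
    have hc : ∀ Z : M2, (P * conjSL P).1 * Z = Z * (P * conjSL P).1 ∧
        (P * conjSL P).1 * (P * conjSL P).1 = 1 := by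
      intro Z
      rcases hP with ⟨h, -⟩ | ⟨h, -⟩ <;> rw [h] <;> simp
    rw [(hc Y).1, mul_assoc, (hc Y).2, mul_one]
  rw [twist, map_mul, map_mul, h2, Matrix.SpecialLinearGroup.coe_mul (P * conjSL P) P,
    ← conjSL_coe, ← mul_assoc, ← mul_assoc, ← mul_assoc, h1]
  have hcc : cj (cj Y) = Y := by ext i j; simp
  rw [hcc, h3]

theorem trace_twist (P : SL(2, ℂ)) (Y : M2) : (twist P Y).trace = starRingEnd ℂ Y.trace := by
  rw [twist, mul_assoc, Matrix.trace_mul_comm, mul_assoc, ← Matrix.SpecialLinearGroup.coe_mul,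
    inv_mul_cancel, Matrix.SpecialLinearGroup.coe_one, mul_one, Matrix.trace_fin_two,
    Matrix.trace_fin_two]
  simp

/-- As `P P̄` is central, `twist P` is an antilinear involution. Its traceless fixed points form a
real form of the traceless matrices, and `Y` is recovered from its two fixed components by
`eq_combination`. -/
theorem isFixed_add_twist (hP : IsSign (P * conjSL P) δ) {Y : M2} (hY : Y.trace = 0) :
    IsFixed P (Y + twist P Y) where
  trace_eq := by rw [Matrix.trace_add, trace_twist, hY, map_zero, add_zero]
  comm := by rw [map_add, mul_add, mul_cj_twist hP, add_mul, twist_mul, add_comm]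

theorem isFixed_sub_twist (hP : IsSign (P * conjSL P) δ) {Y : M2} (hY : Y.trace = 0) :
    IsFixed P (Complex.I • (Y - twist P Y)) where
  trace_eq := by
    rw [Matrix.trace_smul, Matrix.trace_sub, trace_twist, hY, map_zero, sub_zero, smul_zero]
  comm := by
    rw [cj_smul, map_sub, mul_smul_comm, mul_sub, mul_cj_twist hP, smul_mul_assoc, sub_mul,
      twist_mul, Complex.conj_I, neg_smul, ← smul_neg, neg_sub]

theorem eq_combination (P : SL(2, ℂ)) (Y : M2) :
    Y = (1 / 2 : ℂ) • (Y + twist P Y) + (-(Complex.I / 2)) • (Complex.I • (Y - twist P Y)) := by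
  have : -(Complex.I / 2) * Complex.I = 1 / 2 := by
    linear_combination (-(1 / 2 : ℂ)) * Complex.I_sq
  rw [smul_smul, this, ← smul_add, add_add_sub_cancel, ← two_smul ℂ, smul_smul]
  norm_num

theorem exists_fixed_ne_zero (hP : IsSign (P * conjSL P) δ) : ∃ ξ, IsFixed P ξ ∧ ξ ≠ 0 := by
  have hY : (!![0, 1; 0, 0] : M2).trace = 0 := by simp [Matrix.trace_fin_two]
  by_contra! hne
  have h1 := hne _ (isFixed_add_twist hP hY)
  have h2 := hne _ (isFixed_sub_twist hP hY)
  have h3 := eq_combination P !![0, 1; 0, 0]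
  rw [h1, h2, smul_zero, smul_zero, add_zero] at h3
  have := congrFun (congrFun h3 0) 1
  simp at this

/-- The image of `ad B` on traceless matrices is not contained in a line. -/
theorem not_proportional_commutators {B : SL(2, ℂ)} (h1 : B ≠ 1) (h2 : B ≠ -1) (Z : M2) :
    ¬ ∀ Y : M2, Y.trace = 0 → ∃ c : ℂ, B.1 * Y - Y * B.1 = c • Z := by
  intro h
  obtain ⟨a, ha⟩ := h !![0, 1; 0, 0] (by simp [Matrix.trace_fin_two])
  obtain ⟨b, hb⟩ := h !![0, 0; 1, 0] (by simp [Matrix.trace_fin_two])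
  obtain ⟨c, hc⟩ := h !![1, 0; 0, -1] (by simp [Matrix.trace_fin_two])
  have ent : ∀ {M N : M2}, M = N → M 0 0 = N 0 0 ∧ M 0 1 = N 0 1 ∧ M 1 0 = N 1 0 := by
    rintro M _ rfl
    exact ⟨rfl, rfl, rfl⟩
  obtain ⟨a1, a2, a3⟩ := ent ha
  obtain ⟨b1, b2, b3⟩ := ent hb
  obtain ⟨c1, c2, c3⟩ := ent hc
  simp only [Matrix.sub_apply, Matrix.mul_apply, Fin.sum_univ_two, Matrix.smul_apply, smul_eq_mul,
    Matrix.of_apply, Matrix.cons_val', Matrix.cons_val_zero, Matrix.cons_val_one,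
    Matrix.cons_val_fin_one] at a1 a2 a3 b1 b2 b3 c1 c2 c3
  -- Multiples of one matrix have vanishing `2 × 2` minors. The minors used are, up to constants,
  -- the squares of the off-diagonal entries and of the difference of the diagonal ones.
  have e1 : B.1 1 0 = 0 := by
    refine mul_self_eq_zero.1 ?_
    linear_combination (-1 / 2 * a1) * (c * Z 1 0) + B.1 1 0 / 2 * c3 +
      (c * Z 0 0 / 2) * a3
  have e2 : B.1 0 1 = 0 := by
    refine mul_self_eq_zero.1 ?_
    linear_combination (-1 / 2) * ((c * Z 0 1) * b1 + B.1 0 1 * c2 - (c * Z 0 0) * b2)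
  have e3 : B.1 0 0 - B.1 1 1 = 0 := by
    refine mul_self_eq_zero.1 ?_
    linear_combination -((b * Z 1 0) * a2 + (B.1 0 0 - B.1 1 1) * b3 - (a * Z 1 0) * b2)
  exact (eq_one_or_eq_neg_one e1 e2 (sub_eq_zero.1 e3)).elim h1 h2

/-- Reality of `tr (ξ B)` is at most one real linear condition. If all fixed `ξ` satisfying it
commuted with `B`, the commutators of `B` with fixed matrices, hence with all traceless ones, would
lie on one complex line. -/
theorem exists_fixed_not_commute (hP : IsSign (P * conjSL P) δ) {B : SL(2, ℂ)} (h1 : B ≠ 1)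
    (h2 : B ≠ -1) :
    ∃ ξ, IsFixed P ξ ∧ (ξ * B.1).trace.im = 0 ∧ B.1 * ξ ≠ ξ * B.1 := by
  by_contra! hne
  have hspan : ∃ Z : M2, ∀ η, IsFixed P η → ∃ c : ℂ, B.1 * η - η * B.1 = c • Z := by
    by_cases h0 : ∀ η, IsFixed P η → (η * B.1).trace.im = 0
    · exact ⟨0, fun η hη => ⟨0, by rw [hne η hη (h0 η hη), sub_self, smul_zero]⟩⟩
    · push Not at h0
      obtain ⟨ξ, hξ, hξ0⟩ := h0
      refine ⟨B.1 * ξ - ξ * B.1, fun η hη => ?_⟩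
      set a := (η * B.1).trace.im / (ξ * B.1).trace.im with ha
      have hf : IsFixed P (η - (a : ℂ) • ξ) :=
        ⟨by rw [Matrix.trace_sub, Matrix.trace_smul, hη.trace_eq, hξ.trace_eq]; simp,
          by rw [map_sub, cj_smul, Complex.conj_ofReal, mul_sub, sub_mul, mul_smul_comm,
            smul_mul_assoc, hη.comm, hξ.comm]⟩
      have := hne _ hf (by
        rw [sub_mul, Matrix.trace_sub, smul_mul_assoc, Matrix.trace_smul, smul_eq_mul,
          Complex.sub_im, Complex.im_ofReal_mul, ha, div_mul_cancel₀ _ hξ0, sub_self])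
      refine ⟨a, ?_⟩
      rw [mul_sub, sub_mul, mul_smul_comm, smul_mul_assoc] at this
      rw [smul_sub, sub_eq_sub_iff_sub_eq_sub, this]
  obtain ⟨Z, hZ⟩ := hspan
  refine not_proportional_commutators h1 h2 Z fun Y hY => ?_
  obtain ⟨c, hc⟩ := hZ _ (isFixed_add_twist hP hY)
  obtain ⟨d, hd⟩ := hZ _ (isFixed_sub_twist hP hY)
  refine ⟨1 / 2 * c + -(Complex.I / 2) * d, ?_⟩
  have e := eq_combination P Y
  generalize Y + twist P Y = Y₁ at *
  generalize Complex.I • (Y - twist P Y) = Y₂ at *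
  rw [e, mul_add, add_mul, add_smul, mul_smul, mul_smul, ← hc, ← hd, smul_sub, smul_sub]
  simp only [mul_smul_comm, smul_mul_assoc]
  abel

/-- `E = P P̄'` represents the product of `[P] c` and `[P'] c`, and each of them inverts it up to
the sign `δ δ'`. Hence each sends `F = E - E⁻¹` to `-δ δ' F`, and `F` or `i F` is fixed by both. If
`F = 0`, then `P'` is a multiple of `P`. -/
theorem exists_common_fixed {P' : SL(2, ℂ)} {δ' : ℝ} (hP : IsSign (P * conjSL P) δ)
    (hP' : IsSign (P' * conjSL P') δ') : ∃ ξ, IsFixed P ξ ∧ IsFixed P' ξ ∧ ξ ≠ 0 := by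
  set E := P * conjSL P' with hE
  set S := (P * conjSL P) * (P' * conjSL P') with hS
  have sS : IsSign S (δ * δ') := hP.mul hP'
  have k1 : P * conjSL E = S * E⁻¹ * P := by
    have : E⁻¹ * P = P' * conjSL P' * P' := by rw [← inv_conjSL hP', hE]; group
    have dd : P' * conjSL P' * (P' * conjSL P') = 1 := by
      nth_rewrite 1 [← hP'.inv]
      exact inv_mul_cancel _
    rw [mul_assoc S, this, hE, map_mul, conjSL_conjSL, hS]
    calc P * (conjSL P * P') = P * conjSL P * (P' * conjSL P' * (P' * conjSL P')) * P' := by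
          rw [dd]; group
      _ = _ := by simp only [mul_assoc]
  have k2 : P' * conjSL E = S * E⁻¹ * P' := by
    have h1 := hP.comm P'
    have h2 := hP.comm P⁻¹
    symm
    calc S * E⁻¹ * P' = P * conjSL P * P' * P⁻¹ * P' := by rw [hS, hE]; group
      _ = P' * (P⁻¹ * (P * conjSL P)) * P' := by
        rw [← h1, h2]; simp only [mul_assoc]
      _ = _ := by rw [hE, map_mul, conjSL_conjSL]; group
  set F : M2 := E.1 - (E⁻¹).1 with hF
  have hFt : F.trace = 0 := by
    rw [hF, Matrix.trace_sub, Matrix.trace_fin_two, Matrix.trace_fin_two, inv_00, inv_11]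
    ring
  have hfix : ∀ R : SL(2, ℂ), R * conjSL E = S * E⁻¹ * R →
      R.1 * cj F = (-(δ * δ' : ℝ) : ℂ) • (F * R.1) := by
    intro R hR
    have hR' : R * (conjSL E)⁻¹ = S * E * R := by
      rw [mul_inv_eq_iff_eq_mul, mul_assoc _ R, hR]
      rw [mul_assoc S E, mul_assoc S E⁻¹, ← mul_assoc E S, sS.comm E]
      rw [mul_assoc S E, mul_inv_cancel_left, ← mul_assoc]
      nth_rewrite 1 [← sS.inv]
      rw [inv_mul_cancel, one_mul]
    have e1 : R.1 * cj E.1 = (S * E⁻¹ * R).1 := by rw [← hR]; rfl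
    have e2 : R.1 * cj (E⁻¹).1 = (S * E * R).1 := by rw [← hR', ← map_inv]; rfl
    rw [hF, map_sub, mul_sub, e1, e2]
    simp only [Matrix.SpecialLinearGroup.coe_mul, sS.coe]
    simp only [smul_mul_assoc, one_mul, sub_mul, smul_sub, neg_smul]
    abel
  have f1 := hfix P k1
  have f2 := hfix P' k2
  by_cases hF0 : F = 0
  · have hEs : E = 1 ∨ E = -1 := by
      have e : E.1 = (E⁻¹).1 := sub_eq_zero.1 hF0
      have g1 := congrFun (congrFun e 0) 0
      have g2 := congrFun (congrFun e 0) 1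
      have g3 := congrFun (congrFun e 1) 0
      rw [inv_00] at g1
      rw [inv_01] at g2
      rw [inv_10] at g3
      exact eq_one_or_eq_neg_one (by linear_combination g3 / 2) (by linear_combination g2 / 2) g1
    obtain ⟨ξ, hξ, hξ0⟩ := exists_fixed_ne_zero hP
    refine ⟨ξ, hξ, ⟨hξ.trace_eq, ?_⟩, hξ0⟩
    have hZ : ∃ z : ℂ, P'.1 = z • P.1 := by
      obtain ⟨η, hη⟩ : ∃ η, IsSign E η := by
        rcases hEs with h | h
        · exact ⟨1, Or.inl ⟨h, rfl⟩⟩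
        · exact ⟨-1, Or.inr ⟨h, rfl⟩⟩
      have e : P' = (P' * conjSL P') * E * P := by
        have ee : E * E = 1 := by
          nth_rewrite 1 [← hη.inv]
          exact inv_mul_cancel _
        have h1 : P' * conjSL P' = P' * P⁻¹ * E := by rw [hE]; group
        rw [h1, mul_assoc _ E E, ee]
        group
      refine ⟨δ' * η, ?_⟩
      conv_lhs => rw [e]
      simp only [Matrix.SpecialLinearGroup.coe_mul (P' * conjSL P' * E),
        Matrix.SpecialLinearGroup.coe_mul (P' * conjSL P'), hP'.coe, hη.coe]
      simp only [smul_mul_assoc, one_mul, smul_smul]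
    obtain ⟨z, hz⟩ := hZ
    rw [hz, smul_mul_assoc, hξ.comm, mul_smul_comm]
  · have hδ : δ * δ' = 1 ∨ δ * δ' = -1 := sS.imp And.right And.right
    rcases hδ with h | h
    · rw [h] at f1 f2
      have hfixI : ∀ R : SL(2, ℂ), R.1 * cj F = (-(1 : ℝ) : ℂ) • (F * R.1) →
          IsFixed R (Complex.I • F) := fun R hR =>
        ⟨by rw [Matrix.trace_smul, hFt, smul_zero], by
          rw [cj_smul, mul_smul_comm, hR, smul_smul, smul_mul_assoc, Complex.conj_I]; simp⟩
      exact ⟨_, hfixI P f1, hfixI P' f2, smul_ne_zero Complex.I_ne_zero hF0⟩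
    · rw [h] at f1 f2
      exact ⟨F, ⟨hFt, by rw [f1]; simp⟩, ⟨hFt, by rw [f2]; simp⟩, hF0⟩

end existence

/-! ### Density at triples with central squares -/

section

variable {C : SL(2, ℂ)} {ε : ℝ}

theorem isSign_of_central {A : SL(2, ℂ)} (h : A = 1 ∨ A = -1) : ∃ δ, IsSign A δ := by
  rcases h with h | h
  · exact ⟨1, Or.inl ⟨h, rfl⟩⟩
  · exact ⟨-1, Or.inr ⟨h, rfl⟩⟩

theorem IsSign.ne_zero {δ : ℝ} (h : IsSign C δ) : δ ≠ 0 := left_ne_zero_of_mul_eq_one h.mul_self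

theorem IsSign.eq_or {δ : ℝ} (h : IsSign C δ) : C = 1 ∨ C = -1 := h.imp And.left And.left

theorem IsSign.left_of_mul {x y z : SL(2, ℂ)} {δ δ' : ℝ} (hC : IsSign C ε) (hy : IsSign y δ)
    (hz : IsSign z δ') (h : x * y * z = C) : x = 1 ∨ x = -1 := by
  have e : x = C * z⁻¹ * y⁻¹ := by rw [← h]; group
  rw [hz.inv, hy.inv] at e
  rw [e]
  exact ((hC.mul hz).mul hy).eq_or

theorem tr_eq_trace (A : SL(2, ℂ)) : tr A = A.1.trace := (Matrix.trace_fin_two _).symm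

/-- Triples in `X₃(C)` whose last square only is central are limits of non-commuting ones. -/
theorem mem_closure_of_one_central (hC : IsSign C ε) {A : Fin 3 → G} (hA : A ∈ X 3 C)
    (h2 : Q (A 2) = 1 ∨ Q (A 2) = -1) (h0 : Q (A 0) ≠ 1 ∧ Q (A 0) ≠ -1) :
    A ∈ closure (X' 3 C) := by
  obtain ⟨hG, hprod⟩ := mem_X_iff.1 hA
  obtain ⟨δ, hδ⟩ := isSign_of_central h2
  obtain ⟨P, hP⟩ := exists_refl (hG 2)
  obtain ⟨P₀, hP₀⟩ := exists_refl (hG 0)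
  have hδ' : IsSign (P * conjSL P) δ := by rwa [hP, Q_refl] at hδ
  set B := Q (A 0) with hB
  have hBre : (tr B).im = 0 := by rw [hB, hP₀, Q_refl]; exact tr_mul_conjSL_im P₀
  -- `A 0` is kept, `A 2` is bent along `ξ`, and `B₁ t` is the square then required of `A 1`.
  -- Reality of `tr (ξ B)` makes its trace real, hence liftable; `B ξ ≠ ξ B` breaks commutation.
  obtain ⟨ξ, hξ, hξr, hξc⟩ := exists_fixed_not_commute hδ' h0.1 h0.2
  let R : ℝ → SL(2, ℂ) := fun t => bend P ξ t * conjSL (bend P ξ t)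
  have hRc : ContinuousAt R 0 :=
    (continuousAt_bend P ξ).mul (continuous_conjSL.continuousAt.comp (continuousAt_bend P ξ))
  have hR0 : R 0 = Q (A 2) := by simp only [R, bend_zero, hP, Q_refl]
  let B₁ : ℝ → SL(2, ℂ) := fun t => B⁻¹ * C * (R t)⁻¹
  have hB₁c : ContinuousAt B₁ 0 := continuousAt_const.mul hRc.inv
  have hB₁0 : B₁ 0 = Q (A 1) := by
    simp only [B₁, hR0]
    rw [← hprod]; group
  have h1 : Q (A 1) ≠ 1 ∧ Q (A 1) ≠ -1 := by
    rw [← not_or]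
    intro h
    obtain ⟨δ', hδ₁⟩ := isSign_of_central h
    exact (hC.left_of_mul hδ₁ hδ hprod).elim h0.1 h0.2
  rw [mem_closure_iff_nhds]
  intro U hU
  have hUc : ∀ᶠ p : G × G in 𝓝 (A 1, A 2), ![A 0, p.1, p.2] ∈ U := by
    have hc : Continuous fun p : G × G => ![A 0, p.1, p.2] := by
      refine continuous_pi fun i => ?_
      fin_cases i
      · exact continuous_const
      · exact continuous_fst
      · exact continuous_snd
    refine hc.continuousAt.eventually_mem ?_
    have : ![A 0, A 1, A 2] = A := by funext i; fin_cases i <;> rfl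
    rwa [this]
  obtain ⟨V₁, hV₁, V₂, hV₂, hV⟩ := mem_nhds_prod_iff.1 hUc
  have ev1 : ∀ᶠ t in 𝓝[≠] (0 : ℝ), (tr (B₁ t)).im = 0 → ∃ g' ∈ V₁, g' ∈ Gminus ∧ Q g' = B₁ t := by
    have := exists_near_Q_eq (hG 1) h1.1 h1.2 hV₁
    rw [← hB₁0] at this
    exact (hB₁c.eventually this).filter_mono nhdsWithin_le_nhds
  have ev2 : ∀ᶠ t in 𝓝[≠] (0 : ℝ), refl (bend P ξ t) ∈ V₂ := by
    refine Eventually.filter_mono nhdsWithin_le_nhds ?_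
    refine (continuous_refl.continuousAt.comp (continuousAt_bend P ξ)).eventually_mem ?_
    simp only [Function.comp, bend_zero, ← hP]
    exact hV₂
  have ev3 := (bend_mul_conj hδ' hξ).filter_mono (nhdsWithin_le_nhds (s := {0}ᶜ))
  obtain ⟨t, ht1, ht2, ⟨κ, hκ, hκt⟩, ht0⟩ :=
    (ev1.and (ev2.and (ev3.and self_mem_nhdsWithin))).exists
  have hκδ : ((κ * δ : ℝ) : ℂ) ≠ 0 := by
    exact_mod_cast mul_ne_zero hκ.ne' hδ.ne_zero
  have htr : (tr (B₁ t)).im = 0 := by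
    have e : B₁ t = (R t * B)⁻¹ * C := by
      simp only [B₁, mul_inv_rev]
      rw [mul_assoc, ← hC.comm, mul_assoc]
    rw [e, tr_inv_mul_sign hC, Complex.im_ofReal_mul, tr_eq_trace,
      Matrix.SpecialLinearGroup.coe_mul, hκt, smul_mul_assoc, Matrix.trace_smul, smul_eq_mul,
      Complex.im_ofReal_mul, add_mul, smul_mul_assoc, smul_mul_assoc, one_mul, Matrix.trace_add,
      Matrix.trace_smul, Matrix.trace_smul, ← tr_eq_trace, smul_eq_mul, smul_eq_mul]
    have i1 : (1 - (t : ℂ) ^ 2 * ξ.det).im = 0 := by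
      have := hξ.det_real
      simp [← Complex.ofReal_pow, this]
    have i2 : (2 * (t : ℂ)).im = 0 := by simp
    simp [Complex.add_im, Complex.mul_im (1 - (t : ℂ) ^ 2 * ξ.det),
      Complex.mul_im (2 * (t : ℂ)), i1, i2, hBre, hξr]
  obtain ⟨g', hg', hgm, hgQ⟩ := ht1 htr
  refine ⟨![A 0, g', refl (bend P ξ t)], hV (Set.mk_mem_prod hg' ht2), ?_⟩
  have hQR : Q (refl (bend P ξ t)) = R t := Q_refl _
  refine mem_X'_of_not_commute (mem_X_iff.2 ⟨?_, ?_⟩) ?_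
  · intro i
    fin_cases i
    · exact hG 0
    · exact hgm
    · exact refl_mem _
  · simp only [Matrix.cons_val]
    rw [hgQ, hQR, ← hB]
    simp only [B₁]
    group
  · simp only [Matrix.cons_val]
    rw [hgQ, ← hB]
    intro hcomm
    have hc1 : Commute B (B₁ t) := hcomm
    have hc2 : Commute B (R t) := by
      have e : R t = (B₁ t)⁻¹ * B⁻¹ * C := by simp only [B₁]; group
      rw [e]
      have hc3 : Commute B C := hC.comm B
      exact (hc1.inv_right.mul_right (Commute.refl B).inv_right).mul_right hc3
    have hm : B.1 * (R t).1 = (R t).1 * B.1 := by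
      rw [← Matrix.SpecialLinearGroup.coe_mul, hc2.eq, Matrix.SpecialLinearGroup.coe_mul]
    rw [hκt, mul_smul_comm, smul_mul_assoc] at hm
    have hm2 := smul_right_injective M2 hκδ hm
    rw [mul_add, add_mul, mul_smul_comm, mul_smul_comm, smul_mul_assoc, smul_mul_assoc, mul_one,
      one_mul, add_right_inj] at hm2
    have ht' : (2 * (t : ℂ)) ≠ 0 := by
      simpa using ht0
    exact hξc (smul_right_injective M2 ht' hm2)

/-- Triples in `X₃(C)` with central squares are limits of non-commuting ones. -/
theorem mem_closure_of_central (hC : IsSign C ε) {A : Fin 3 → G} (hA : A ∈ X 3 C)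
    (hc : ∀ i, Q (A i) = 1 ∨ Q (A i) = -1) : A ∈ closure (X' 3 C) := by
  obtain ⟨hG, hprod⟩ := mem_X_iff.1 hA
  obtain ⟨P₀, hP₀⟩ := exists_refl (hG 0)
  obtain ⟨P₁, hP₁⟩ := exists_refl (hG 1)
  obtain ⟨δ₀, hδ₀⟩ := isSign_of_central (hc 0)
  obtain ⟨δ₁, hδ₁⟩ := isSign_of_central (hc 1)
  rw [hP₀, Q_refl] at hδ₀
  rw [hP₁, Q_refl] at hδ₁
  obtain ⟨ξ, hξ₀, hξ₁, hξ⟩ := exists_common_fixed hδ₀ hδ₁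
  -- Opposite bendings preserve the product of the two squares: `(a + 2 t ξ)(a - 2 t ξ)` is scalar.
  let p : ℝ → Fin 3 → G := fun t => ![refl (bend P₀ ξ t), refl (bend P₁ (-ξ) t), A 2]
  have hp0 : p 0 = A := by
    funext i
    fin_cases i
    · simp [p, bend_zero, hP₀]
    · simp [p, bend_zero, hP₁]
    · rfl
  have hpc : ContinuousAt p 0 := by
    refine continuousAt_pi.2 fun i => ?_
    fin_cases i
    · exact continuous_refl.continuousAt.comp (continuousAt_bend P₀ ξ)
    · exact continuous_refl.continuousAt.comp (continuousAt_bend P₁ (-ξ))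
    · exact continuousAt_const
  -- The bent triples have a non-central first square and a central last one, so they are themselves
  -- only limits of non-commuting triples.
  rw [← hp0, ← closure_closure]
  refine mem_closure_of_path hpc ?_
  filter_upwards [(bend_mul_conj hδ₀ hξ₀).filter_mono (nhdsWithin_le_nhds (s := {0}ᶜ)),
    (bend_mul_conj hδ₁ hξ₁.neg).filter_mono (nhdsWithin_le_nhds (s := {0}ᶜ)),
    self_mem_nhdsWithin] with t h₀ h₁ ht
  obtain ⟨κ₀, hκ₀, e₀⟩ := h₀
  obtain ⟨κ₁, hκ₁, e₁⟩ := h₁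
  rw [← Q_refl] at e₀ e₁
  have hdet : (-ξ).det = ξ.det := by rw [Matrix.det_neg]; simp
  rw [hdet] at e₁
  have hprod' : Q (refl (bend P₀ ξ t)) * Q (refl (bend P₁ (-ξ) t)) =
      P₀ * conjSL P₀ * (P₁ * conjSL P₁) := by
    have e : (Q (refl (bend P₀ ξ t)) * Q (refl (bend P₁ (-ξ) t))).1 =
        ((κ₀ * κ₁ * (1 + t ^ 2 * ξ.det.re) ^ 2 : ℝ) : ℂ) •
          (P₀ * conjSL P₀ * (P₁ * conjSL P₁)).1 := by
      have hd : ξ.det = ξ.det.re := Complex.ext rfl (by simpa using hξ₀.det_real)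
      rw [Matrix.SpecialLinearGroup.coe_mul, e₀, e₁, Matrix.SpecialLinearGroup.coe_mul, hδ₀.coe,
        hδ₁.coe, smul_mul_smul_comm, smul_mul_smul_comm, smul_smul, mul_one]
      have hexp : ((1 - (t : ℂ) ^ 2 * ξ.det) • (1 : M2) + (2 * (t : ℂ)) • ξ) *
          ((1 - (t : ℂ) ^ 2 * ξ.det) • (1 : M2) + (2 * (t : ℂ)) • -ξ) =
          ((1 + (t : ℂ) ^ 2 * ξ.det) ^ 2) • (1 : M2) := by
        have hs := mul_self_of_trace hξ₀.trace_eq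
        simp only [add_mul, mul_add, smul_mul_smul_comm, mul_one, one_mul, mul_neg, hs]
        module
      rw [hexp, smul_smul]
      congr 1
      push_cast
      rw [← hd]
      ring
    -- Both sides have determinant one, so the scalar is `± 1`; being nonnegative it is `1`.
    rcases scalar_sq_eq_one e with hk | hk
    · apply Subtype.ext
      rw [e, hk, one_smul]
    · exfalso
      have h1 : κ₀ * κ₁ * (1 + t ^ 2 * ξ.det.re) ^ 2 = -1 := by exact_mod_cast hk
      have h2 : 0 ≤ κ₀ * κ₁ * (1 + t ^ 2 * ξ.det.re) ^ 2 := by positivity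
      linarith
  refine mem_closure_of_one_central hC (mem_X_iff.2 ⟨?_, ?_⟩) (hc 2) ?_
  · intro i
    fin_cases i
    · exact refl_mem _
    · exact refl_mem _
    · exact hG 2
  · simp only [p, Matrix.cons_val]
    rw [hprod', ← Q_refl, ← Q_refl, ← hP₀, ← hP₁, hprod]
  · simp only [p, Matrix.cons_val]
    rw [← not_or]
    intro h
    obtain ⟨δ, hδ⟩ := isSign_of_central h
    rw [hδ.coe] at e₀
    have ht' : (2 * (t : ℂ)) ≠ 0 := by simpa using ht
    have hκδ : ((κ₀ * δ₀ : ℝ) : ℂ) ≠ 0 := by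
      exact_mod_cast mul_ne_zero hκ₀.ne' hδ₀.ne_zero
    have hs : ∀ i j, ((κ₀ * δ₀ : ℝ) : ℂ) * (2 * t) * ξ i j =
        ((δ : ℂ) - ((κ₀ * δ₀ : ℝ) : ℂ) * (1 - (t : ℂ) ^ 2 * ξ.det)) * (1 : M2) i j := by
      intro i j
      have := congrFun (congrFun e₀ i) j
      simp only [Matrix.smul_apply, Matrix.add_apply, smul_eq_mul] at this
      linear_combination -this
    have hne := mul_ne_zero hκδ ht'
    have k01 := hs 0 1
    have k10 := hs 1 0
    have k00 := hs 0 0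
    have k11 := hs 1 1
    simp only [Matrix.one_apply_eq, Matrix.one_apply_ne (show (0 : Fin 2) ≠ 1 by decide),
      Matrix.one_apply_ne (show (1 : Fin 2) ≠ 0 by decide), mul_zero, mul_one] at k01 k10 k00 k11
    have htr := hξ₀.trace_eq
    rw [Matrix.trace_fin_two] at htr
    have z01 := (mul_eq_zero.1 k01).resolve_left hne
    have z10 := (mul_eq_zero.1 k10).resolve_left hne
    have zd : ξ 0 0 = ξ 1 1 := mul_left_cancel₀ hne (k00.trans k11.symm)
    apply hξ
    ext i j
    fin_cases i <;> fin_cases j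
    · change ξ 0 0 = 0; linear_combination (htr + zd) / 2
    · exact z01
    · exact z10
    · change ξ 1 1 = 0; linear_combination (htr - zd) / 2

theorem mem_closure_of_last_central (hC : IsSign C ε) {A : Fin 3 → G} (hA : A ∈ X 3 C)
    (h2 : Q (A 2) = 1 ∨ Q (A 2) = -1) : A ∈ closure (X' 3 C) := by
  by_cases h0 : Q (A 0) = 1 ∨ Q (A 0) = -1
  · refine mem_closure_of_central hC hA fun i => ?_
    obtain ⟨δ₀, hδ₀⟩ := isSign_of_central h0
    obtain ⟨δ₂, hδ₂⟩ := isSign_of_central h2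
    fin_cases i
    · exact h0
    · have e := (mem_X_iff.1 (shift_mem_X hC hA)).2
      exact hC.left_of_mul (x := Q (A 1)) (y := Q (A 2)) (z := Q (A 0)) hδ₂ hδ₀ e
    · exact h2
  · exact mem_closure_of_one_central hC hA h2 (not_or.1 h0)

/-- `X'₃(C)` is dense in `X₃(C)`. -/
theorem X_subset_closure (hC : IsSign C ε) : X 3 C ⊆ closure (X' 3 C) := by
  intro A hA
  by_cases h : ∀ i, Q (A i) ≠ 1 ∧ Q (A i) ≠ -1
  · exact mem_closure_of_noncentral hC hA h
  · push Not at h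
    obtain ⟨i, hi⟩ := h
    have hi' : Q (A i) = 1 ∨ Q (A i) = -1 := or_iff_not_imp_left.2 hi
    have hs := shift_mem_X hC hA
    have hss := shift_mem_X hC hs
    fin_cases i
    · rw [← shift_shift_shift A]
      exact shift_mem_closure hC (shift_mem_closure hC (mem_closure_of_last_central hC hs hi'))
    · rw [← shift_shift_shift A]
      exact shift_mem_closure hC (mem_closure_of_last_central hC hss hi')
    · exact mem_closure_of_last_central hC hA hi'

theorem isConnected_X (hC : IsSign C ε) : IsConnected (X 3 C) :=
  (isConnected_X' hC).subset_closure (fun _ h => h.1) (X_subset_closure hC)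

end

/-! ### Representations and the second Stiefel-Whitney class -/

/-- The inclusion `SL(2, ℂ) → SL(2, ℂ) ⋊ Z2`. -/
abbrev inlTilde : SL(2, ℂ) →* Gtilde := SemidirectProduct.inl

theorem sq_tilde (x : Gtilde) (hx : x.right = flip) : x ^ 2 = inlTilde (x.left * conjSL x.left) := by
  rw [pow_two]
  refine SemidirectProduct.ext ?_ ?_
  · rw [SemidirectProduct.mul_left, hx, involutionAction_flip]
    rfl
  · rw [SemidirectProduct.mul_right, hx, flip_mul_flip]
    rfl

theorem cover_right (x : Gtilde) : (cover x).right = x.right := rfl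

theorem cover_refl (A : SL(2, ℂ)) : cover ⟨A, flip⟩ = refl A := rfl

theorem Q_cover (x : Gtilde) (hx : x.right = flip) : Q (cover x) = x.left * conjSL x.left := by
  have : cover x = refl x.left := SemidirectProduct.ext rfl hx
  rw [this, Q_refl]

/-- `A Ā` does not depend on the sign of `A`, so `Q g` is a canonical lift of `g²`. The relator
therefore holds in `G` exactly when the lifted relator is `±1`. -/
theorem sq_of_mem_Gminus {g : G} (hg : g ∈ Gminus) : g ^ 2 = cover (inlTilde (Q g)) := by
  obtain ⟨A, rfl⟩ := exists_refl hg
  rw [← cover_refl, ← map_pow, sq_tilde _ rfl, cover_refl, Q_refl]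

theorem cover_inl_eq_one_iff {A : SL(2, ℂ)} : cover (inlTilde A) = 1 ↔ A = 1 ∨ A = -1 := by
  rw [← mk_eq_one_iff]
  constructor
  · intro h
    exact congrArg SemidirectProduct.left h
  · intro h
    exact SemidirectProduct.ext h rfl

section hom

variable {n : ℕ}

theorem lift_relator {H : Type*} [Group H] (f : Fin n → H) :
    FreeGroup.lift f (relator n) = (List.ofFn fun i => f i ^ 2).prod := by
  rw [relator, map_list_prod, List.map_ofFn]
  congr 2
  funext i
  simp

theorem lift_relator_tilde (x : Fin n → Gtilde) (hx : ∀ i, (x i).right = flip) :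
    FreeGroup.lift x (relator n) = inlTilde (liftedRelator fun i => cover (x i)) := by
  rw [lift_relator, liftedRelator, map_list_prod, List.map_ofFn]
  congr 2
  funext i
  rw [sq_tilde _ (hx i), ← Q_cover _ (hx i)]
  rfl

theorem lift_relator_of_mem {A : Fin n → G} (hA : ∀ i, A i ∈ Gminus) :
    FreeGroup.lift A (relator n) = cover (inlTilde (liftedRelator A)) := by
  rw [lift_relator, liftedRelator, map_list_prod, map_list_prod, List.map_ofFn, List.map_ofFn]
  congr 2
  funext i
  rw [sq_of_mem_Gminus (hA i)]
  rfl

theorem onGenerators_mem (φ : HomTP n) (i : Fin n) : onGenerators φ i ∈ Gminus := by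
  refine (φ.2 _).2 ?_
  rw [orientationChar, PresentedGroup.toGroup.of]
  exact flip_ne_one

theorem lift_relator_eq_one {H : Type*} [Group H] (φ : piN n →* H) :
    FreeGroup.lift (fun i => φ (PresentedGroup.of i)) (relator n) = 1 := by
  have e : FreeGroup.lift (fun i => φ (PresentedGroup.of i)) =
      φ.comp (PresentedGroup.mk {relator n}) := by
    ext i
    simp [PresentedGroup.of]
  have h1 : PresentedGroup.mk {relator n} (relator n) = 1 :=
    PresentedGroup.one_of_mem (Set.mem_singleton _)
  rw [e, MonoidHom.comp_apply, h1, map_one]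

theorem liftedRelator_onGenerators (φ : HomTP n) :
    liftedRelator (onGenerators φ) = 1 ∨ liftedRelator (onGenerators φ) = -1 := by
  have h := lift_relator_of_mem (onGenerators_mem φ)
  rw [← cover_inl_eq_one_iff, ← h]
  exact lift_relator_eq_one φ.1

theorem one_ne_neg_one : (1 : SL(2, ℂ)) ≠ -1 := by
  intro h
  have := congrArg (fun M : SL(2, ℂ) => M.1 0 0) h
  simp at this
  norm_num [Complex.ext_iff] at this

theorem w2_eq_zero_iff (φ : HomTP n) : w2 φ = 0 ↔ liftedRelator (onGenerators φ) = 1 := by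
  unfold w2
  split_ifs with h <;> simp [h]

theorem w2_eq_one_iff (φ : HomTP n) : w2 φ = 1 ↔ liftedRelator (onGenerators φ) = -1 := by
  unfold w2
  split_ifs with h
  · simp [h, one_ne_neg_one]
  · simp [(liftedRelator_onGenerators φ).resolve_left h]

theorem exists_onGenerators {A : Fin n → G} (hA : ∀ i, A i ∈ Gminus)
    (h : liftedRelator A = 1 ∨ liftedRelator A = -1) : ∃ φ : HomTP n, onGenerators φ = A := by
  have hrel : ∀ r ∈ ({relator n} : Set (FreeGroup (Fin n))), FreeGroup.lift A r = 1 := by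
    rintro r rfl
    rw [lift_relator_of_mem hA, cover_inl_eq_one_iff]
    exact h
  have horient : SemidirectProduct.rightHom.comp (PresentedGroup.toGroup hrel) =
      orientationChar n := by
    refine PresentedGroup.ext fun i => ?_
    rw [MonoidHom.comp_apply, PresentedGroup.toGroup.of, orientationChar,
      PresentedGroup.toGroup.of]
    exact eq_flip_of_ne_one (hA i)
  refine ⟨⟨PresentedGroup.toGroup hrel, fun γ => ?_⟩, funext fun i => PresentedGroup.toGroup.of hrel⟩
  rw [← horient]
  rfl

theorem injective_onGenerators : Function.Injective (onGenerators : HomTP n → Fin n → G) := by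
  intro φ ψ h
  exact Subtype.ext (PresentedGroup.ext fun i => congrFun h i)

theorem isEmbedding_onGenerators : IsEmbedding (onGenerators : HomTP n → Fin n → G) := by
  refine ⟨⟨le_antisymm ?_ ?_⟩, injective_onGenerators⟩
  · refine continuous_iff_le_induced.1 (continuous_pi fun i => ?_)
    exact (continuous_apply _).comp continuous_induced_dom
  · refine continuous_iff_le_induced.1 ?_
    let : TopologicalSpace (HomTP n) := TopologicalSpace.induced onGenerators inferInstance
    have hgen : Continuous (onGenerators : HomTP n → Fin n → G) := continuous_induced_dom
    refine continuous_pi fun γ => ?_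
    -- `G` is a topological group, so the `γ` with continuous evaluation form a subgroup; it
    -- contains the generators.
    let S : Subgroup (piN n) :=
      { carrier := {γ | Continuous fun φ : HomTP n => φ.1 γ}
        mul_mem' := fun {a b} ha hb => by
          simp only [Set.mem_ofPred_eq, map_mul] at *
          exact ha.mul hb
        one_mem' := by
          simp only [Set.mem_ofPred_eq, map_one]
          exact continuous_const
        inv_mem' := fun {a} ha => by
          simp only [Set.mem_ofPred_eq, map_inv] at *
          exact ha.inv }
    have hS : S = ⊤ := by
      rw [eq_top_iff, ← PresentedGroup.closure_range_of, Subgroup.closure_le]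
      rintro _ ⟨i, rfl⟩
      exact (continuous_apply i).comp hgen
    have : γ ∈ S := hS ▸ Subgroup.mem_top γ
    exact this

theorem image_w2_zero : onGenerators '' {φ : HomTP n | w2 φ = 0} = X n 1 := by
  ext A
  constructor
  · rintro ⟨φ, hφ, rfl⟩
    exact ⟨onGenerators_mem φ, (w2_eq_zero_iff φ).1 hφ⟩
  · rintro ⟨h1, h2⟩
    obtain ⟨φ, rfl⟩ := exists_onGenerators h1 (Or.inl h2)
    exact ⟨φ, (w2_eq_zero_iff φ).2 h2, rfl⟩

theorem image_w2_one : onGenerators '' {φ : HomTP n | w2 φ = 1} = X n (-1) := by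
  ext A
  constructor
  · rintro ⟨φ, hφ, rfl⟩
    exact ⟨onGenerators_mem φ, (w2_eq_one_iff φ).1 hφ⟩
  · rintro ⟨h1, h2⟩
    obtain ⟨φ, rfl⟩ := exists_onGenerators h1 (Or.inr h2)
    exact ⟨φ, (w2_eq_one_iff φ).2 h2, rfl⟩

/-- Whatever lifts of the generators are chosen, their relator is the lifted relator, so lifting is
possible for all choices or for none. -/
theorem w2_eq_zero_iff_lift (φ : HomTP n) :
    w2 φ = 0 ↔ ∃ ψ : piN n →* Gtilde, cover.comp ψ = φ.1 := by
  rw [w2_eq_zero_iff]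
  constructor
  · intro h
    choose A hA using fun i => exists_refl (onGenerators_mem φ i)
    let x : Fin n → Gtilde := fun i => ⟨A i, flip⟩
    have hx : (fun i => cover (x i)) = onGenerators φ := funext fun i => (hA i).symm
    have hrel : ∀ r ∈ ({relator n} : Set (FreeGroup (Fin n))), FreeGroup.lift x r = 1 := by
      rintro r rfl
      rw [lift_relator_tilde x fun i => rfl, hx, h, map_one]
    refine ⟨PresentedGroup.toGroup hrel, PresentedGroup.ext fun i => ?_⟩
    rw [MonoidHom.comp_apply, PresentedGroup.toGroup.of]
    exact congrFun hx i
  · rintro ⟨ψ, hψ⟩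
    have hc : ∀ i, cover (ψ (PresentedGroup.of i)) = onGenerators φ i := fun i =>
      DFunLike.congr_fun hψ (PresentedGroup.of i)
    have h := lift_relator_tilde (fun i => ψ (PresentedGroup.of i)) fun i => by
      rw [← cover_right, hc]
      exact eq_flip_of_ne_one (onGenerators_mem φ i)
    rw [lift_relator_eq_one ψ] at h
    simp only [hc] at h
    exact SemidirectProduct.inl_injective (h.symm.trans (map_one _).symm)

/-- The two fibres are complementary, and each is closed as the preimage of the point `1` or `-1`
under the lifted relator. -/
theorem isClopen_w2_fibre (φ : HomTP n) : IsClopen {ψ : HomTP n | w2 ψ = w2 φ} := by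
  have hcont : Continuous fun ψ : HomTP n => liftedRelator (onGenerators ψ) :=
    continuous_liftedRelator.comp isEmbedding_onGenerators.continuous
  have c0 : IsClosed {ψ : HomTP n | w2 ψ = 0} := by
    simp only [w2_eq_zero_iff]
    exact isClosed_singleton.preimage hcont
  have c1 : IsClosed {ψ : HomTP n | w2 ψ = 1} := by
    simp only [w2_eq_one_iff]
    exact isClosed_singleton.preimage hcont
  have hor : ∀ z : ZMod 2, z = 0 ∨ z = 1 := by decide
  have hcompl : {ψ : HomTP n | w2 ψ = 0}ᶜ = {ψ : HomTP n | w2 ψ = 1} := by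
    ext ψ
    rcases hor (w2 ψ) with h | h <;> simp [h]
  have k0 : IsClopen {ψ : HomTP n | w2 ψ = 0} := ⟨c0, by
    rw [← isClosed_compl_iff, hcompl]; exact c1⟩
  rcases hor (w2 φ) with h | h
  · rw [h]; exact k0
  · rw [h, ← hcompl]; exact k0.compl

end hom

theorem isPreconnected_w2_fibre (φ : HomTP 3) : IsPreconnected {ψ : HomTP 3 | w2 ψ = w2 φ} := by
  have hor : ∀ z : ZMod 2, z = 0 ∨ z = 1 := by decide
  rcases hor (w2 φ) with h | h
  · rw [h, ← isEmbedding_onGenerators.isInducing.isPreconnected_image, image_w2_zero]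
    exact (isConnected_X (Or.inl ⟨rfl, rfl⟩)).isPreconnected
  · rw [h, ← isEmbedding_onGenerators.isInducing.isPreconnected_image, image_w2_one]
    exact (isConnected_X (Or.inr ⟨rfl, rfl⟩)).isPreconnected

end IsomH3

end

open IsomH3 in
theorem mainTheorem6 :
    (IsConnected (X' 3 1) ∧ IsConnected (X' 3 (-1))) ∧
    (X 3 1 ⊆ closure (X' 3 1) ∧ X 3 (-1) ⊆ closure (X' 3 (-1))) ∧
    (IsConnected (X 3 1) ∧ IsConnected (X 3 (-1))) ∧
    Topology.IsEmbedding (onGenerators : HomTP 3 → Fin 3 → G) ∧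
    onGenerators '' {φ : HomTP 3 | w2 φ = 0} = X 3 1 ∧
    onGenerators '' {φ : HomTP 3 | w2 φ = 1} = X 3 (-1) ∧
    (∀ φ : HomTP 3, w2 φ = 0 ↔ ∃ ψ : piN 3 →* Gtilde, cover.comp ψ = φ.1) ∧
    (∀ φ : HomTP 3, connectedComponent φ = {ψ | w2 ψ = w2 φ}) := by
  have s₁ : IsSign 1 1 := Or.inl ⟨rfl, rfl⟩
  have s₂ : IsSign (-1) (-1) := Or.inr ⟨rfl, rfl⟩
  refine ⟨⟨isConnected_X' s₁, isConnected_X' s₂⟩, ⟨X_subset_closure s₁, X_subset_closure s₂⟩,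
    ⟨isConnected_X s₁, isConnected_X s₂⟩, isEmbedding_onGenerators, image_w2_zero, image_w2_one,
    w2_eq_zero_iff_lift, fun φ => Set.Subset.antisymm ?_ ?_⟩
  · exact (isClopen_w2_fibre φ).connectedComponent_subset rfl
  · exact (isPreconnected_w2_fibre φ).subset_connectedComponent rfl
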